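/- Let $\mathcal H_A,\mathcal H_B$ be finite-dimensional Hilbert spaces, let $\rho_1,\rho_2$ be density matrices on $\mathcal H_A$ and $\sigma_1,\sigma_2$ density matrices on $\mathcal H_B$. For density matrices $\rho,\sigma$ on the same space write $\rho\ll\sigma$ if $\operatorname{supp}\rho\subseteq\operatorname{supp}\sigma$ and $\rho\perp\sigma$ if the supports are orthogonal (the support being the span of the eigenvectors with positive eigenvalue), and define: - for $\alpha\in[0,1]$, the hypothesis testing divergence $D_H^\alpha(\rho\|\sigma)=\max\{-\ln\mathrm{Tr}[(\mathbb I-\Lambda)\sigma] : 0\preceq\Lambda\preceq\mathbb I,\ \mathrm{Tr}[\Lambda\rho]\le\alpha\}\in[0,+\infty]$; - for $\gamma\ge 0$, the hockey-stick divergence $E_\gamma(\rho\|\sigma)=\max_{0\preceq\Lambda\preceq\mathbb I}\mathrm{Tr}[\Lambda(\rho-\gamma\sigma)]$; - for $\tilde\alpha\in[0,1)\cup(1,\infty)$, the hockey-stick Rényi divergence $D_{\tilde\alpha}(\rho\|\sigma)=\frac1{\tilde\alpha-1}\log\bigl(1+(\tilde\alpha-1)H_{\tilde\alpha}(\rho\|\sigma)\bigr)$,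 where $H_{\tilde\alpha}(\rho\|\sigma)=\tilde\alpha\int_1^\infty\bigl(\gamma^{\tilde\alpha-2}E_\gamma(\rho\|\sigma)+\gamma^{-\tilde\alpha-1}E_\gamma(\sigma\|\rho)\bigr)\,d\gamma$ (with $0\cdot\infty=0$), if either $\tilde\alpha<1$ and $\rho\not\perp\sigma$, or $\rho\ll\sigma$; and $D_{\tilde\alpha}(\rho\|\sigma)=+\infty$ otherwise; - the quantum relative entropy $D(\rho\|\sigma)=\mathrm{Tr}[\rho(\log\rho-\log\sigma)]$ if $\rho\ll\sigma$ (logarithms taken on the supports), and $D(\rho\|\sigma)=+\infty$ otherwise. Suppose that $D_H^\alpha(\rho_1\|\rho_2)\ge D_H^\alpha(\sigma_1\|\sigma_2)$ for all $\alpha\in[0,1]$. Then 1. $E_\gamma(\rho_1\|\rho_2)\ge E_\gamma(\sigma_1\|\sigma_2)$ for all $\gamma\ge 0$; 2. $D_{\tilde\alpha}(\rho_1\|\rho_2)\ge D_{\tilde\alpha}(\sigma_1\|\sigma_2)$ for all $\tilde\alpha\in[0,1)\cup(1,\infty)$; and the order $\tilde\alpha=0$ is covered also when it is read as a limit: $\limsup_{\tilde\alpha\downarrow0}D_{\tilde\alpha}(\rho_1\|\rho_2)\ge\limsup_{\tilde\alpha\downarrow0}D_{\tilde\alpha}(\sigma_1\|\sigma_2)$;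 3. $D(\rho_1\|\rho_2)\ge D(\sigma_1\|\sigma_2)$. -/

import Mathlib

open Filter Topology MeasureTheory
open scoped ENNReal Matrix ComplexOrder

namespace QuantumDivergence

noncomputable section

variable {n : Type*} [Fintype n] [DecidableEq n]

/-- Density matrices: positive semidefinite complex matrices of trace one. -/
structure IsDensity (ρ : Matrix n n ℂ) : Prop where
  posSemidef : ρ.PosSemidef
  trace_eq_one : ρ.trace = 1

/-- A test (effect) `Λ`, that is `0 ≼ Λ ≼ 1` in the Loewner order. -/
structure IsTest (Λ : Matrix n n ℂ) : Prop where
  posSemidef : Λ.PosSemidef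
  one_sub_posSemidef : (1 - Λ).PosSemidef

/-- The support of a state: the span of its eigenvectors with positive eigenvalue. -/
def supp (ρ : Matrix n n ℂ) : Submodule ℂ (EuclideanSpace ℂ n) :=
  ⨆ (μ : ℝ) (_ : 0 < μ), Module.End.eigenspace (Matrix.toEuclideanLin ρ) (μ : ℂ)

/-- `ρ ≪ σ`: the support of `ρ` is contained in the support of `σ`. -/
def Dominated (ρ σ : Matrix n n ℂ) : Prop := supp ρ ≤ supp σ

/-- `ρ ⊥ σ`: the supports of `ρ` and `σ` are orthogonal. -/
def Orthogonal (ρ σ : Matrix n n ℂ) : Prop := supp ρ ⟂ supp σ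

/-- The hypothesis testing divergence
`D_H^α(ρ‖σ) = max { -ln Tr[(1 - Λ) σ] : 0 ≼ Λ ≼ 1, Tr[Λ ρ] ≤ α }`,
with values in the extended reals (`-ln 0 = +∞`). -/
def hypothesisTestingDiv (α : ℝ) (ρ σ : Matrix n n ℂ) : EReal :=
  ⨆ (Λ : Matrix n n ℂ) (_ : IsTest Λ ∧ (Λ * ρ).trace.re ≤ α),
    -ENNReal.log (ENNReal.ofReal ((1 - Λ) * σ).trace.re)

/-- The hockey stick divergence `E_γ(ρ‖σ) = max { Tr[Λ (ρ - γ σ)] : 0 ≼ Λ ≼ 1 }`. -/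
def hockeyStick (γ : ℝ) (ρ σ : Matrix n n ℂ) : ℝ :=
  sSup {x : ℝ | ∃ Λ : Matrix n n ℂ, IsTest Λ ∧ x = (Λ * (ρ - (γ : ℂ) • σ)).trace.re}

/-- `H_α(ρ‖σ) = α ∫_1^∞ (γ^(α-2) E_γ(ρ‖σ) + γ^(-α-1) E_γ(σ‖ρ)) dγ`, a number in `[0, ∞]`
(with `0 · ∞ = 0`). -/
def hockeyStickH (α : ℝ) (ρ σ : Matrix n n ℂ) : ℝ≥0∞ :=
  ENNReal.ofReal α * ∫⁻ γ in Set.Ioi (1 : ℝ),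
    ENNReal.ofReal (γ ^ (α - 2) * hockeyStick γ ρ σ + γ ^ (-α - 1) * hockeyStick γ σ ρ)

open scoped Classical in
/-- The hockey stick Rényi divergence
`D_α(ρ‖σ) = (α - 1)⁻¹ log (1 + (α - 1) H_α(ρ‖σ))` of order `α ∈ [0,1) ∪ (1,∞)`, when `α < 1` and
`ρ`, `σ` are not orthogonal, or `ρ ≪ σ`; and `+∞` otherwise. In the first case `H_α` is finite and
the argument of the logarithm is positive. -/
def hockeyStickRenyi (α : ℝ) (ρ σ : Matrix n n ℂ) : EReal :=
  if (α < 1 ∧ ¬ Orthogonal ρ σ) ∨ Dominated ρ σ then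
    (((α - 1)⁻¹ * Real.log (1 + (α - 1) * (hockeyStickH α ρ σ).toReal) : ℝ) : EReal)
  else ⊤

open scoped Classical in
/-- The quantum relative entropy: `Tr[ρ (log ρ - log σ)]` if `ρ ≪ σ`, and `+∞` otherwise. The
logarithms are taken on the supports (`Real.log 0 = 0` in the functional calculus). -/
def relativeEntropy (ρ σ : Matrix n n ℂ) : EReal :=
  if Dominated ρ σ then
    ((ρ * (cfc Real.log ρ - cfc Real.log σ)).trace.re : EReal)
  else ⊤

end

end QuantumDivergence

/-! The hypothesis compares achievable error pairs: every test `Λ` for `(σ₁, σ₂)` is matched by a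
test for `(ρ₁, ρ₂)` whose first error is no larger and whose second error is larger by at most an
arbitrary `ε > 0`. Both `E_γ(ρ‖σ)` and `E_γ(σ‖ρ)` optimize a linear function of the error pair that
is monotone in each error for `γ ≥ 0`, so both orders of the hockey-stick divergence inherit the
inequality.

For the Rényi divergences, `H_α` is an integral of these quantities with nonnegative weights, and
the outer function is increasing. The conditions in the definition can also be read off: the states
are orthogonal iff `E_1 ≥ 1`, and `ρ ≪ σ` iff `E_γ(ρ‖σ)` vanishes for some `γ ≥ 0`.

The relative entropy follows from the formula, valid for `ρ ≪ σ`, `D(ρ‖σ) = ∫_1^∞ (γ⁻¹ E_γ(ρ‖σ) +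
γ⁻² E_γ(σ‖ρ)) dγ`. Let `F(u) = Tr[(ρ + u)(log(ρ + u) - log(σ + u))]`. Then `F(0) = D(ρ‖σ)`, `F(∞) =
0`, and `-F'(u) = ∑ (τ - 1 - log τ)` over the generalized eigenvalues `τ` of the pencil `(ρ + u, σ +
u)`. A layer cake formula expresses each summand through the events `τ > γ` and `τ⁻¹ > γ`. By
Sylvester's law, the number of `τ > γ` is the number of eigenvalues of `ρ - γσ` above `(γ - 1)u`,
and its integral over `u > 0` is `E_γ(ρ‖σ)/(γ - 1)`; the other event is symmetric. Tonelli's theorem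
gives the formula (`lintegral_entropyRate`, `Dominated.relativeEntropy_eq_lintegral`). -/

namespace QuantumDivergence

noncomputable section

variable {n : Type*} [Fintype n] [DecidableEq n]
variable {m : Type*} [Fintype m] [DecidableEq m]

/-! ### Spectral decompositions and optimal tests -/

/-- `U` is unitary and diagonalizes `A`, with eigenvalues `e`. -/
structure Diagonalizes (U : Matrix n n ℂ) (e : n → ℝ) (A : Matrix n n ℂ) : Prop where
  left : Uᴴ * U = 1
  right : U * Uᴴ = 1
  eq : A = U * Matrix.diagonal (fun i => (e i : ℂ)) * Uᴴ

theorem diagonalizes_eigenvalues {A : Matrix n n ℂ} (hA : A.IsHermitian) :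
    Diagonalizes (hA.eigenvectorUnitary : Matrix n n ℂ) hA.eigenvalues A where
  left := Unitary.coe_star_mul_self _
  right := Unitary.coe_mul_star_self _
  eq := hA.spectral_theorem

theorem exists_diagonalizes {A : Matrix n n ℂ} (hA : A.IsHermitian) :
    ∃ U e, Diagonalizes U e A := ⟨_, _, diagonalizes_eigenvalues hA⟩

theorem cfc_eq_conj_diagonal {A : Matrix n n ℂ} (hA : A.IsHermitian) (f : ℝ → ℝ) :
    cfc f A = (hA.eigenvectorUnitary : Matrix n n ℂ) *
      Matrix.diagonal (fun i => (f (hA.eigenvalues i) : ℂ)) *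
        (hA.eigenvectorUnitary : Matrix n n ℂ)ᴴ := by
  rw [hA.cfc_eq]; rfl

theorem trace_mul_conj_diagonal (M U : Matrix n n ℂ) (d : n → ℂ) :
    (M * (U * Matrix.diagonal d * Uᴴ)).trace = ∑ i, (Uᴴ * M * U) i i * d i := by
  have : (M * (U * Matrix.diagonal d * Uᴴ)).trace
      = (Uᴴ * M * U * Matrix.diagonal d).trace := by
    rw [← Matrix.mul_assoc, Matrix.trace_mul_comm]
    simp only [Matrix.mul_assoc]
  rw [this]
  simp [Matrix.trace, Matrix.mul_diagonal]

theorem re_trace_mul_conj_diagonal (M U : Matrix n n ℂ) (d : n → ℝ) :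
    (M * (U * Matrix.diagonal (fun i => (d i : ℂ)) * Uᴴ)).trace.re
      = ∑ i, ((Uᴴ * M * U) i i).re * d i := by
  simp [trace_mul_conj_diagonal]

theorem posSemidef_conj_diagonal (U : Matrix n n ℂ) {d : n → ℝ} (hd : ∀ i, 0 ≤ d i) :
    (U * Matrix.diagonal (fun i => (d i : ℂ)) * Uᴴ).PosSemidef := by
  apply Matrix.PosSemidef.mul_mul_conjTranspose_same
  rw [Matrix.posSemidef_diagonal_iff]
  intro i
  exact_mod_cast hd i

namespace Diagonalizes

variable {U : Matrix n n ℂ} {e : n → ℝ} {A : Matrix n n ℂ}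

theorem one_eq (h : Diagonalizes U e A) :
    (1 : Matrix n n ℂ) = U * Matrix.diagonal (fun _ => ((1 : ℝ) : ℂ)) * Uᴴ := by
  simp [h.right]

theorem sub_smul_one (h : Diagonalizes U e A) (c : ℝ) :
    Diagonalizes U (fun i => e i - c) (A - (c : ℂ) • 1) where
  left := h.left
  right := h.right
  eq := by
    have : Matrix.diagonal (fun i => ((e i - c : ℝ) : ℂ))
        = Matrix.diagonal (fun i => (e i : ℂ)) - (c : ℂ) • 1 := by
      ext i j
      by_cases hij : i = j <;> simp [hij]
    rw [this, Matrix.mul_sub, Matrix.sub_mul, ← h.eq]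
    simp [h.right]

theorem trace (h : Diagonalizes U e A) : A.trace = ∑ i, (e i : ℂ) := by
  rw [h.eq, Matrix.trace_mul_cycle, h.left, Matrix.one_mul, Matrix.trace_diagonal]

theorem det (h : Diagonalizes U e A) : A.det = ∏ i, (e i : ℂ) := by
  rw [h.eq, Matrix.det_mul_right_comm, h.right, Matrix.one_mul, Matrix.det_diagonal]

theorem conj_apply (h : Diagonalizes U e A) (i : n) : (Uᴴ * A * U) i i = e i := by
  rw [h.eq]
  have : Uᴴ * (U * Matrix.diagonal (fun i => (e i : ℂ)) * Uᴴ) * U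
      = (Uᴴ * U) * Matrix.diagonal (fun i => (e i : ℂ)) * (Uᴴ * U) := by
    simp only [Matrix.mul_assoc]
  rw [this, h.left]; simp

theorem posSemidef (h : Diagonalizes U e A) (he : ∀ i, 0 ≤ e i) : A.PosSemidef :=
  h.eq ▸ posSemidef_conj_diagonal U he

theorem nonneg (h : Diagonalizes U e A) (hA : A.PosSemidef) (i : n) : 0 ≤ e i := by
  have := (hA.conjTranspose_mul_mul_same U).diag_nonneg (i := i)
  rw [h.conj_apply] at this
  exact_mod_cast this

/-- The spectral test `1_{e ∈ s}(A)`. -/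
theorem isTest_conj_diagonal (h : Diagonalizes U e A) {d : n → ℝ} (h0 : ∀ i, 0 ≤ d i)
    (h1 : ∀ i, d i ≤ 1) : IsTest (U * Matrix.diagonal (fun i => (d i : ℂ)) * Uᴴ) where
  posSemidef := posSemidef_conj_diagonal U h0
  one_sub_posSemidef := by
    have : 1 - U * Matrix.diagonal (fun i => (d i : ℂ)) * Uᴴ
        = U * Matrix.diagonal (fun i => ((1 - d i : ℝ) : ℂ)) * Uᴴ := by
      rw [h.one_eq, ← Matrix.sub_mul, ← Matrix.mul_sub, Matrix.diagonal_sub]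
      push_cast; rfl
    rw [this]
    exact posSemidef_conj_diagonal U fun i => sub_nonneg.2 (h1 i)

/-- In an eigenbasis of `A` only the diagonal of `Λ` enters the trace, and its entries lie in `[0,
1]`. The projector onto the positive eigenvalues is therefore optimal. -/
theorem isGreatest_trace_test (h : Diagonalizes U e A) :
    IsGreatest {x : ℝ | ∃ Λ : Matrix n n ℂ, IsTest Λ ∧ x = (Λ * A).trace.re}
      (∑ i, max (e i) 0) := by
  constructor
  · refine ⟨U * Matrix.diagonal (fun i => ((if 0 < e i then 1 else 0 : ℝ) : ℂ)) * Uᴴ,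
      h.isTest_conj_diagonal (fun i => by positivity) (fun i => by split_ifs <;> norm_num), ?_⟩
    rw [Matrix.trace_mul_comm, re_trace_mul_conj_diagonal]
    refine Finset.sum_congr rfl fun i _ => ?_
    rw [h.conj_apply]
    split_ifs with hi
    · simp [hi.le]
    · simp [not_lt.1 hi]
  · rintro x ⟨Λ, hΛ, rfl⟩
    rw [h.eq, re_trace_mul_conj_diagonal]
    refine Finset.sum_le_sum fun i _ => ?_
    have h0 := (hΛ.posSemidef.conjTranspose_mul_mul_same U).diag_nonneg (i := i)
    have h1 := (hΛ.one_sub_posSemidef.conjTranspose_mul_mul_same U).diag_nonneg (i := i)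
    rw [Matrix.mul_sub, Matrix.mul_one, Matrix.sub_mul, h.left] at h1
    have h0' : 0 ≤ ((Uᴴ * Λ * U) i i).re := (Complex.le_def.1 h0).1
    have h1' : 0 ≤ 1 - ((Uᴴ * Λ * U) i i).re := by simpa using (Complex.le_def.1 h1).1
    rcases le_total (e i) 0 with hi | hi
    · rw [max_eq_right hi]; exact mul_nonpos_of_nonneg_of_nonpos h0' hi
    · rw [max_eq_left hi]; nlinarith

end Diagonalizes

theorem re_trace_mul_nonneg {A B : Matrix n n ℂ} (hA : A.PosSemidef) (hB : B.PosSemidef) :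
    0 ≤ (A * B).trace.re := by
  have h := diagonalizes_eigenvalues hB.1
  rw [h.eq, re_trace_mul_conj_diagonal]
  refine Finset.sum_nonneg fun i _ => mul_nonneg ?_ (h.nonneg hB i)
  exact (Complex.le_def.1 (hA.conjTranspose_mul_mul_same _).diag_nonneg).1

open scoped MatrixOrder in
-- With `A = CᴴC` and `B = DᴴD`, the trace is the squared Hilbert–Schmidt norm of `C Dᴴ`.
theorem mul_eq_zero_of_re_trace_mul_eq_zero {A B : Matrix n n ℂ} (hA : A.PosSemidef)
    (hB : B.PosSemidef) (h : (A * B).trace.re = 0) : A * B = 0 := by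
  obtain ⟨C, hC⟩ := CStarAlgebra.nonneg_iff_eq_star_mul_self.mp hA.nonneg
  obtain ⟨D, hD⟩ := CStarAlgebra.nonneg_iff_eq_star_mul_self.mp hB.nonneg
  rw [Matrix.star_eq_conjTranspose] at hC hD
  have hpsd := Matrix.posSemidef_self_mul_conjTranspose (C * Dᴴ)
  have htr : (C * Dᴴ * (C * Dᴴ)ᴴ).trace = (A * B).trace := by
    rw [hC, hD, Matrix.conjTranspose_mul, Matrix.conjTranspose_conjTranspose,
      Matrix.mul_assoc Cᴴ, Matrix.trace_mul_comm Cᴴ]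
    simp only [Matrix.mul_assoc]
  have h0 : (C * Dᴴ * (C * Dᴴ)ᴴ).trace = 0 := by
    apply Complex.ext
    · rw [htr, h]; rfl
    · exact (Complex.le_def.1 hpsd.trace_nonneg).2.symm
  have : C * Dᴴ = 0 := Matrix.trace_mul_conjTranspose_self_eq_zero_iff.1 h0
  rw [hC, hD, Matrix.mul_assoc, ← Matrix.mul_assoc C, this]
  simp

/-! ### Elementary properties of the hockey-stick divergence -/

theorem isHermitian_sub_smul {ρ σ : Matrix n n ℂ} (hρ : ρ.IsHermitian) (hσ : σ.IsHermitian)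
    (γ : ℝ) : (ρ - (γ : ℂ) • σ).IsHermitian := by
  refine hρ.sub ?_
  rw [Matrix.IsHermitian, Matrix.conjTranspose_smul, hσ.eq]
  simp

theorem hockeyStick_eq_sum {ρ σ U : Matrix n n ℂ} {e : n → ℝ} {γ : ℝ}
    (h : Diagonalizes U e (ρ - (γ : ℂ) • σ)) : hockeyStick γ ρ σ = ∑ i, max (e i) 0 :=
  h.isGreatest_trace_test.csSup_eq

theorem isGreatest_hockeyStick {ρ σ : Matrix n n ℂ} (hρ : ρ.IsHermitian) (hσ : σ.IsHermitian)
    (γ : ℝ) : IsGreatest {x : ℝ | ∃ Λ : Matrix n n ℂ, IsTest Λ ∧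
      x = (Λ * (ρ - (γ : ℂ) • σ)).trace.re} (hockeyStick γ ρ σ) := by
  have h := diagonalizes_eigenvalues (isHermitian_sub_smul hρ hσ γ)
  rw [hockeyStick_eq_sum h]
  exact h.isGreatest_trace_test

theorem re_trace_mul_sub_smul (Λ ρ σ : Matrix n n ℂ) (γ : ℝ) :
    (Λ * (ρ - (γ : ℂ) • σ)).trace.re = (Λ * ρ).trace.re - γ * (Λ * σ).trace.re := by
  simp [Matrix.mul_sub, Matrix.trace_sub]

theorem re_trace_one_sub_mul {σ : Matrix n n ℂ} (hσ : IsDensity σ) (Λ : Matrix n n ℂ) :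
    ((1 - Λ) * σ).trace.re = 1 - (Λ * σ).trace.re := by
  simp [Matrix.sub_mul, Matrix.trace_sub, hσ.trace_eq_one]

theorem IsTest.one_sub {Λ : Matrix n n ℂ} (h : IsTest Λ) : IsTest (1 - Λ) :=
  ⟨h.one_sub_posSemidef, by simpa using h.posSemidef⟩

theorem IsTest.re_trace_mul_nonneg {Λ ρ : Matrix n n ℂ} (h : IsTest Λ) (hρ : IsDensity ρ) :
    0 ≤ (Λ * ρ).trace.re := QuantumDivergence.re_trace_mul_nonneg h.posSemidef hρ.posSemidef

theorem IsTest.re_trace_mul_le_one {Λ ρ : Matrix n n ℂ} (h : IsTest Λ) (hρ : IsDensity ρ) :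
    (Λ * ρ).trace.re ≤ 1 := by
  have := h.one_sub.re_trace_mul_nonneg hρ
  rw [re_trace_one_sub_mul hρ] at this
  linarith

theorem re_trace_le_hockeyStick {ρ σ Λ : Matrix n n ℂ} (hρ : IsDensity ρ) (hσ : IsDensity σ)
    (γ : ℝ) (hΛ : IsTest Λ) :
    (Λ * ρ).trace.re - γ * (Λ * σ).trace.re ≤ hockeyStick γ ρ σ :=
  (isGreatest_hockeyStick hρ.posSemidef.1 hσ.posSemidef.1 γ).2
    ⟨Λ, hΛ, (re_trace_mul_sub_smul Λ ρ σ γ).symm⟩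

theorem exists_hockeyStick_eq {ρ σ : Matrix n n ℂ} (hρ : IsDensity ρ) (hσ : IsDensity σ)
    (γ : ℝ) : ∃ Λ, IsTest Λ ∧ hockeyStick γ ρ σ = (Λ * ρ).trace.re - γ * (Λ * σ).trace.re := by
  obtain ⟨Λ, hΛ, h⟩ := (isGreatest_hockeyStick hρ.posSemidef.1 hσ.posSemidef.1 γ).1
  exact ⟨Λ, hΛ, h.trans (re_trace_mul_sub_smul Λ ρ σ γ)⟩

theorem isTest_zero : IsTest (0 : Matrix n n ℂ) :=
  ⟨Matrix.PosSemidef.zero, by simpa using Matrix.PosSemidef.one⟩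

theorem hockeyStick_nonneg {ρ σ : Matrix n n ℂ} (hρ : IsDensity ρ) (hσ : IsDensity σ) (γ : ℝ) :
    0 ≤ hockeyStick γ ρ σ := by
  simpa using re_trace_le_hockeyStick hρ hσ γ isTest_zero

theorem hockeyStick_le_one {ρ σ : Matrix n n ℂ} (hρ : IsDensity ρ) (hσ : IsDensity σ) {γ : ℝ}
    (hγ : 0 ≤ γ) : hockeyStick γ ρ σ ≤ 1 := by
  obtain ⟨Λ, hΛ, h⟩ := exists_hockeyStick_eq hρ hσ γ
  have := mul_nonneg hγ (hΛ.re_trace_mul_nonneg hσ)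
  have := hΛ.re_trace_mul_le_one hρ
  linarith

theorem hockeyStick_antitone {ρ σ : Matrix n n ℂ} (hρ : IsDensity ρ) (hσ : IsDensity σ) :
    Antitone fun γ => hockeyStick γ ρ σ := by
  intro a b hab
  obtain ⟨Λ, hΛ, h⟩ := exists_hockeyStick_eq hρ hσ b
  have h1 := re_trace_le_hockeyStick hρ hσ a hΛ
  have := mul_le_mul_of_nonneg_right hab (hΛ.re_trace_mul_nonneg hσ)
  simp only
  linarith

/-- The total variation `E_1` is symmetric on states. -/
theorem hockeyStick_one_comm {ρ σ : Matrix n n ℂ} (hρ : IsDensity ρ) (hσ : IsDensity σ) :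
    hockeyStick 1 ρ σ = hockeyStick 1 σ ρ := by
  have key : ∀ {ρ σ : Matrix n n ℂ}, IsDensity ρ → IsDensity σ →
      hockeyStick 1 ρ σ ≤ hockeyStick 1 σ ρ := by
    intro ρ σ hρ hσ
    obtain ⟨Λ, hΛ, h⟩ := exists_hockeyStick_eq hρ hσ 1
    have := re_trace_le_hockeyStick hσ hρ 1 hΛ.one_sub
    rw [re_trace_one_sub_mul hρ, re_trace_one_sub_mul hσ] at this
    linarith
  exact le_antisymm (key hρ hσ) (key hσ hρ)

/-! ### From hypothesis testing to hockey-stick divergences -/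

/-- An inequality of hypothesis testing divergences transports tests, up to an arbitrarily small
increase of the error of the second kind. -/
theorem exists_test_of_hypothesisTestingDiv_le {ρ₁ ρ₂ : Matrix n n ℂ} {σ₁ σ₂ : Matrix m m ℂ}
    (hσ₁ : IsDensity σ₁) (hσ₂ : IsDensity σ₂)
    (h : ∀ α ∈ Set.Icc (0 : ℝ) 1,
      hypothesisTestingDiv α σ₁ σ₂ ≤ hypothesisTestingDiv α ρ₁ ρ₂)
    {Λ : Matrix m m ℂ} (hΛ : IsTest Λ) {ε : ℝ} (hε : 0 < ε) :
    ∃ M : Matrix n n ℂ, IsTest M ∧ (M * ρ₁).trace.re ≤ (Λ * σ₁).trace.re ∧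
      ((1 - M) * ρ₂).trace.re ≤ ((1 - Λ) * σ₂).trace.re + ε := by
  have hβ := hΛ.one_sub.re_trace_mul_nonneg hσ₂
  have h1 : -ENNReal.log (ENNReal.ofReal ((1 - Λ) * σ₂).trace.re) ≤
      hypothesisTestingDiv (Λ * σ₁).trace.re σ₁ σ₂ :=
    le_iSup₂_of_le (f := fun (Λ : Matrix m m ℂ) (_ : IsTest Λ ∧ _) =>
      -ENNReal.log (ENNReal.ofReal ((1 - Λ) * σ₂).trace.re)) Λ ⟨hΛ, le_rfl⟩ le_rfl
  have h2 := h1.trans (h _ ⟨hΛ.re_trace_mul_nonneg hσ₁, hΛ.re_trace_mul_le_one hσ₁⟩)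
  -- The slack `ε` makes the inequality strict, so that a test can be extracted from the supremum
  -- without knowing that it is attained.
  have h3 : -ENNReal.log (ENNReal.ofReal (((1 - Λ) * σ₂).trace.re + ε)) <
      hypothesisTestingDiv (Λ * σ₁).trace.re ρ₁ ρ₂ := by
    refine lt_of_lt_of_le (EReal.neg_lt_neg_iff.2 (ENNReal.log_strictMono ?_)) h2
    rw [ENNReal.ofReal_lt_ofReal_iff (by linarith)]
    linarith
  obtain ⟨M, hM⟩ := lt_iSup_iff.1 h3
  obtain ⟨⟨hM1, hM2⟩, hM3⟩ := lt_iSup_iff.1 hM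
  refine ⟨M, hM1, hM2, ?_⟩
  rw [EReal.neg_lt_neg_iff, ENNReal.log_strictMono.lt_iff_lt,
    ENNReal.ofReal_lt_ofReal_iff (by linarith)] at hM3
  exact hM3.le

section Comparison

variable {ρ₁ ρ₂ : Matrix n n ℂ} {σ₁ σ₂ : Matrix m m ℂ}

theorem hockeyStick_le_of_hypothesisTestingDiv_le (hρ₁ : IsDensity ρ₁) (hρ₂ : IsDensity ρ₂)
    (hσ₁ : IsDensity σ₁) (hσ₂ : IsDensity σ₂)
    (h : ∀ α ∈ Set.Icc (0 : ℝ) 1,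
      hypothesisTestingDiv α σ₁ σ₂ ≤ hypothesisTestingDiv α ρ₁ ρ₂)
    {γ : ℝ} (hγ : 0 ≤ γ) : hockeyStick γ σ₁ σ₂ ≤ hockeyStick γ ρ₁ ρ₂ := by
  obtain ⟨Λ, hΛ, hE⟩ := exists_hockeyStick_eq hσ₁ hσ₂ γ
  refine le_of_forall_pos_le_add fun ε hε => ?_
  -- The complement of the optimal test has errors `1 - Tr Λσ₁` and `Tr Λσ₂`. The slack is later
  -- multiplied by `γ`; the denominator `γ + 1` also covers `γ = 0`.
  obtain ⟨M, hM, h1, h2⟩ := exists_test_of_hypothesisTestingDiv_le (ρ₁ := ρ₁) (ρ₂ := ρ₂)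
    hσ₁ hσ₂ h hΛ.one_sub (ε := ε / (γ + 1)) (by positivity)
  have h3 := re_trace_le_hockeyStick hρ₁ hρ₂ γ hM.one_sub
  rw [re_trace_one_sub_mul hρ₁] at h3
  rw [re_trace_one_sub_mul hσ₁] at h1
  rw [sub_sub_cancel] at h2
  have h4 := mul_le_mul_of_nonneg_left h2 hγ
  have h5 : γ * (ε / (γ + 1)) ≤ ε := by
    rw [mul_div_assoc', div_le_iff₀ (by positivity)]
    nlinarith
  rw [mul_add] at h4
  linarith

theorem hockeyStick_swap_le_of_hypothesisTestingDiv_le (hρ₁ : IsDensity ρ₁) (hρ₂ : IsDensity ρ₂)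
    (hσ₁ : IsDensity σ₁) (hσ₂ : IsDensity σ₂)
    (h : ∀ α ∈ Set.Icc (0 : ℝ) 1,
      hypothesisTestingDiv α σ₁ σ₂ ≤ hypothesisTestingDiv α ρ₁ ρ₂)
    {γ : ℝ} (hγ : 0 ≤ γ) : hockeyStick γ σ₂ σ₁ ≤ hockeyStick γ ρ₂ ρ₁ := by
  obtain ⟨Λ, hΛ, hE⟩ := exists_hockeyStick_eq hσ₂ hσ₁ γ
  refine le_of_forall_pos_le_add fun ε hε => ?_
  obtain ⟨M, hM, h1, h2⟩ := exists_test_of_hypothesisTestingDiv_le (ρ₁ := ρ₁) (ρ₂ := ρ₂)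
    hσ₁ hσ₂ h hΛ hε
  have h3 := re_trace_le_hockeyStick hρ₂ hρ₁ γ hM
  rw [re_trace_one_sub_mul hρ₂, re_trace_one_sub_mul hσ₂] at h2
  have h4 := mul_le_mul_of_nonneg_left h1 hγ
  linarith

end Comparison

/-! ### Supports -/

theorem supp_eq_range {ρ : Matrix n n ℂ} (hρ : ρ.PosSemidef) :
    supp ρ = LinearMap.range (Matrix.toEuclideanLin ρ) := by
  apply le_antisymm
  · refine iSup₂_le fun μ hμ v hv => ?_
    rw [Module.End.mem_eigenspace_iff] at hv
    refine ⟨(μ : ℂ)⁻¹ • v, ?_⟩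
    rw [map_smul, hv, smul_smul, inv_mul_cancel₀ (by exact_mod_cast hμ.ne'), one_smul]
  · rintro _ ⟨x, rfl⟩
    set b := hρ.1.eigenvectorBasis
    rw [← b.sum_repr x, map_sum]
    refine Submodule.sum_mem _ fun i _ => ?_
    rw [map_smul]
    refine Submodule.smul_mem _ _ ?_
    have hb : Matrix.toEuclideanLin ρ (b i) = (hρ.1.eigenvalues i : ℂ) • b i := by
      have := hρ.1.mulVec_eigenvectorBasis i
      ext j
      simpa using congrFun this j
    rcases (hρ.eigenvalues_nonneg i).eq_or_lt with h0 | h0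
    · rw [hb, ← h0]; simp
    · rw [hb]
      refine Submodule.smul_mem _ _ ?_
      refine Submodule.mem_iSup_of_mem _ (Submodule.mem_iSup_of_mem h0 ?_)
      exact Module.End.mem_eigenspace_iff.2 hb

/-- Passing to orthogonal complements turns relations between supports into equations for matrices
and vectors. -/
theorem ker_toEuclideanLin {ρ : Matrix n n ℂ} (hρ : ρ.PosSemidef) :
    (supp ρ)ᗮ = LinearMap.ker (Matrix.toEuclideanLin ρ) := by
  rw [supp_eq_range hρ]
  exact (Matrix.isSymmetric_toEuclideanLin_iff.2 hρ.1).orthogonal_range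

theorem dominated_iff {ρ σ : Matrix n n ℂ} (hρ : ρ.PosSemidef) (hσ : σ.PosSemidef) :
    Dominated ρ σ ↔ ∀ x : n → ℂ, σ *ᵥ x = 0 → ρ *ᵥ x = 0 := by
  have : Dominated ρ σ ↔ (supp σ)ᗮ ≤ (supp ρ)ᗮ := Submodule.orthogonal_le_orthogonal_iff.symm
  rw [this, ker_toEuclideanLin hρ, ker_toEuclideanLin hσ]
  constructor
  · intro h x hx
    have := @h (WithLp.toLp 2 x) (by simp [Matrix.toLpLin_toLp, hx])
    simpa [Matrix.toLpLin_toLp] using this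
  · intro h x hx
    have := h x.ofLp (by simpa [Matrix.toLpLin_apply] using hx)
    simp [Matrix.toLpLin_apply, this]

theorem orthogonal_iff {ρ σ : Matrix n n ℂ} (hρ : ρ.PosSemidef) (hσ : σ.PosSemidef) :
    Orthogonal ρ σ ↔ ρ * σ = 0 := by
  have : Orthogonal ρ σ ↔ supp σ ≤ (supp ρ)ᗮ :=
    Submodule.isOrtho_comm.trans Submodule.isOrtho_iff_le
  rw [this, ker_toEuclideanLin hρ, supp_eq_range hσ, LinearMap.range_le_ker_iff]
  rw [← Matrix.toEuclideanLin.map_eq_zero_iff]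
  have : Matrix.toEuclideanLin (ρ * σ)
      = Matrix.toEuclideanLin ρ ∘ₗ Matrix.toEuclideanLin σ := by
    ext x
    simp [Matrix.toLpLin_apply]
  rw [this]

theorem IsDensity.ne_zero {ρ : Matrix n n ℂ} (hρ : IsDensity ρ) : ρ ≠ 0 := by
  rintro rfl
  simpa using hρ.trace_eq_one

theorem Dominated.not_orthogonal {ρ σ : Matrix n n ℂ} (hρ : IsDensity ρ) (h : Dominated ρ σ) :
    ¬ Orthogonal ρ σ := by
  intro ho
  have h1 : Orthogonal ρ ρ := Submodule.IsOrtho.mono_right h ho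
  rw [orthogonal_iff hρ.posSemidef hρ.posSemidef] at h1
  refine hρ.ne_zero ?_
  have : ρᴴ * ρ = 0 := by rw [hρ.posSemidef.1.eq, h1]
  exact Matrix.conjTranspose_mul_self_eq_zero.1 this

/-- The value one requires a test that accepts `ρ` and rejects `σ` with certainty. The support
projector of `ρ` does so for orthogonal states; conversely such a test gives `Λσ = 0` and `ρ(1 - Λ)
= 0`, hence `ρσ = 0`. -/
theorem orthogonal_iff_one_le_hockeyStick {ρ σ : Matrix n n ℂ} (hρ : IsDensity ρ)
    (hσ : IsDensity σ) : Orthogonal ρ σ ↔ 1 ≤ hockeyStick 1 ρ σ := by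
  rw [orthogonal_iff hρ.posSemidef hσ.posSemidef]
  constructor
  · intro h
    obtain ⟨U, e, hd⟩ := exists_diagonalizes hρ.posSemidef.1
    have he := hd.nonneg hρ.posSemidef
    set Λ := U * Matrix.diagonal (fun i => ((if 0 < e i then 1 else 0 : ℝ) : ℂ)) * Uᴴ
    have hΛ : IsTest Λ :=
      hd.isTest_conj_diagonal (fun i => by positivity) (fun i => by split_ifs <;> norm_num)
    have h1 : (Λ * ρ).trace.re = 1 := by
      have htr : (∑ i, e i) = 1 := by
        have := hd.trace.symm.trans hρ.trace_eq_one
        exact_mod_cast this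
      rw [← htr, Matrix.trace_mul_comm, re_trace_mul_conj_diagonal]
      refine Finset.sum_congr rfl fun i _ => ?_
      rw [hd.conj_apply]
      split_ifs with hi
      · simp
      · simp [le_antisymm (not_lt.1 hi) (he i)]
    have h2 : Λ * σ = 0 := by
      -- The support projector is the pseudo-inverse of `ρ` times `ρ`, thanks to `0⁻¹ = 0`.
      have : Λ = U * Matrix.diagonal (fun i => (((e i)⁻¹ : ℝ) : ℂ)) * Uᴴ * ρ := by
        have h3 : U * Matrix.diagonal (fun i => (((e i)⁻¹ : ℝ) : ℂ)) * Uᴴ * ρ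
            = U * Matrix.diagonal (fun i => (((e i)⁻¹ : ℝ) : ℂ)) * (Uᴴ * U) *
              Matrix.diagonal (fun i => (e i : ℂ)) * Uᴴ := by
          conv_lhs => rw [hd.eq]
          simp only [Matrix.mul_assoc]
        rw [h3, hd.left, Matrix.mul_one, Matrix.mul_assoc U, Matrix.diagonal_mul_diagonal]
        refine congrArg (fun d => U * Matrix.diagonal d * Uᴴ) (funext fun i => ?_)
        rcases (he i).eq_or_lt with hi | hi
        · simp [← hi]
        · rw [if_pos hi, ← Complex.ofReal_mul, inv_mul_cancel₀ hi.ne']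
      rw [this, Matrix.mul_assoc, h, Matrix.mul_zero]
    have := re_trace_le_hockeyStick hρ hσ 1 hΛ
    rw [h1, h2] at this
    simpa using this
  · intro h
    obtain ⟨Λ, hΛ, hE⟩ := exists_hockeyStick_eq hρ hσ 1
    have a := hΛ.re_trace_mul_nonneg hσ
    have b := hΛ.one_sub.re_trace_mul_nonneg hρ
    have c := re_trace_one_sub_mul hρ Λ
    have h1 := mul_eq_zero_of_re_trace_mul_eq_zero hΛ.posSemidef hσ.posSemidef (by linarith)
    have h2 := mul_eq_zero_of_re_trace_mul_eq_zero hΛ.one_sub_posSemidef hρ.posSemidef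
      (by linarith)
    have h3 : ρ * (1 - Λ) = 0 := by
      have := congrArg Matrix.conjTranspose h2
      simpa [Matrix.conjTranspose_mul, hρ.posSemidef.1.eq, hΛ.posSemidef.1.eq] using this
    calc ρ * σ = ρ * (1 - Λ) * σ + ρ * (Λ * σ) := by noncomm_ring
      _ = 0 := by rw [h3, h1]; simp

theorem hockeyStick_le_zero_iff {ρ σ : Matrix n n ℂ} (hρ : IsDensity ρ) (hσ : IsDensity σ)
    {γ : ℝ} : hockeyStick γ ρ σ ≤ 0 ↔ ((γ : ℂ) • σ - ρ).PosSemidef := by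
  constructor
  · intro h
    obtain ⟨U, e, hd⟩ := exists_diagonalizes
      (isHermitian_sub_smul hρ.posSemidef.1 hσ.posSemidef.1 γ)
    rw [hockeyStick_eq_sum hd] at h
    have h0 := (Finset.sum_eq_zero_iff_of_nonneg fun i _ => le_max_right _ _).1
      (le_antisymm h (Finset.sum_nonneg fun i _ => le_max_right _ _))
    have := posSemidef_conj_diagonal U (fun i => neg_nonneg.2 (max_eq_right_iff.1 (h0 i (Finset.mem_univ i))))
    convert this using 1
    rw [← neg_sub, hd.eq, ← Matrix.neg_mul, ← Matrix.mul_neg, Matrix.diagonal_neg]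
    simp
  · intro h
    obtain ⟨Λ, hΛ, hE⟩ := exists_hockeyStick_eq hρ hσ γ
    have := re_trace_mul_nonneg hΛ.posSemidef h
    rw [← neg_sub, Matrix.mul_neg, Matrix.trace_neg, Complex.neg_re, re_trace_mul_sub_smul] at this
    linarith

theorem dominated_of_posSemidef {ρ σ : Matrix n n ℂ} (hρ : ρ.PosSemidef) (hσ : σ.PosSemidef)
    {γ : ℝ} (h : ((γ : ℂ) • σ - ρ).PosSemidef) : Dominated ρ σ := by
  rw [dominated_iff hρ hσ]
  intro x hx
  rw [← hρ.dotProduct_mulVec_zero_iff]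
  have h1 := h.dotProduct_mulVec_nonneg x
  rw [Matrix.sub_mulVec, Matrix.smul_mulVec, hx, smul_zero, zero_sub, dotProduct_neg] at h1
  exact le_antisymm (neg_nonneg.1 h1) (hρ.dotProduct_mulVec_nonneg x)

theorem Dominated.mul_apply_eq_zero {ρ σ V : Matrix n n ℂ} {s : n → ℝ} (hρ : ρ.PosSemidef)
    (hσ : σ.PosSemidef) (h : Dominated ρ σ) (hV : Diagonalizes V s σ) {j : n} (hj : s j = 0)
    (i : n) : (ρ * V) i j = 0 := by
  rw [dominated_iff hρ hσ] at h
  have h1 : σ *ᵥ (V *ᵥ Pi.single j 1) = 0 := by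
    rw [Matrix.mulVec_mulVec, hV.eq, Matrix.mul_assoc, hV.left, Matrix.mul_one,
      ← Matrix.mulVec_mulVec, Matrix.diagonal_mulVec_single, hj]
    simp
  have h2 := h _ h1
  rw [Matrix.mulVec_mulVec] at h2
  simpa using congrFun h2 i

theorem IsDensity.one_sub_posSemidef {ρ : Matrix n n ℂ} (hρ : IsDensity ρ) :
    (1 - ρ).PosSemidef := by
  obtain ⟨U, e, hd⟩ := exists_diagonalizes hρ.posSemidef.1
  have htr : (∑ i, e i) = 1 := by
    have := hd.trace.symm.trans hρ.trace_eq_one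
    exact_mod_cast this
  have he := hd.nonneg hρ.posSemidef
  rw [hd.eq]
  refine (hd.isTest_conj_diagonal he fun i => ?_).one_sub_posSemidef
  rw [← htr]
  exact Finset.single_le_sum (f := e) (fun i _ => he i) (Finset.mem_univ i)

/-- With `P` the support projector of `σ`, domination gives `ρ = PρP ≤ P`, and `P` is bounded by a
multiple of `σ`. -/
theorem Dominated.exists_posSemidef {ρ σ : Matrix n n ℂ} (hρ : IsDensity ρ) (hσ : σ.PosSemidef)
    (h : Dominated ρ σ) : ∃ γ : ℝ, ((γ : ℂ) • σ - ρ).PosSemidef := by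
  obtain ⟨V, s, hV⟩ := exists_diagonalizes hσ.1
  have hs := hV.nonneg hσ
  set D : Matrix n n ℂ := Matrix.diagonal (fun i => ((if 0 < s i then 1 else 0 : ℝ) : ℂ))
  have hDD : D * D = D := by
    rw [Matrix.diagonal_mul_diagonal]
    refine congrArg Matrix.diagonal (funext fun i => ?_)
    split_ifs <;> simp
  set P := V * D * Vᴴ
  have hP : P.PosSemidef := posSemidef_conj_diagonal V (fun i => by positivity)
  have hPP : P * P = P := by
    calc P * P = V * D * (Vᴴ * V) * D * Vᴴ := by simp only [P, Matrix.mul_assoc]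
      _ = P := by rw [hV.left, Matrix.mul_one, Matrix.mul_assoc V, hDD]
  have hVD : ρ * V * D = ρ * V := by
    ext i j
    rw [Matrix.mul_diagonal]
    rcases (hs j).eq_or_lt with hj | hj
    · rw [h.mul_apply_eq_zero hρ.posSemidef hσ hV hj.symm, zero_mul]
    · simp [hj]
  have hρP : ρ * P = ρ := by
    calc ρ * P = ρ * V * D * Vᴴ := by simp only [P, Matrix.mul_assoc]
      _ = ρ := by rw [hVD, Matrix.mul_assoc, hV.right, Matrix.mul_one]
  have hPρ : P * ρ = ρ := by
    have := congrArg Matrix.conjTranspose hρP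
    rwa [Matrix.conjTranspose_mul, hP.1.eq, hρ.posSemidef.1.eq] at this
  -- Since `0⁻¹ = 0`, this sum dominates the inverse of every positive eigenvalue of `σ`.
  refine ⟨∑ i, (s i)⁻¹, ?_⟩
  have h1 : (P - ρ).PosSemidef := by
    have := hρ.one_sub_posSemidef.mul_mul_conjTranspose_same P
    rwa [hP.1.eq, Matrix.mul_sub, Matrix.mul_one, Matrix.sub_mul, hPP, hPρ, hρP] at this
  have h2 : (((∑ i, (s i)⁻¹ : ℝ) : ℂ) • σ - P).PosSemidef := by
    have := posSemidef_conj_diagonal V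
      (d := fun j => (∑ i, (s i)⁻¹) * s j - if 0 < s j then 1 else 0) (fun j => by
        split_ifs with hj
        · have := Finset.single_le_sum (f := fun i => (s i)⁻¹)
            (fun i _ => inv_nonneg.2 (hs i)) (Finset.mem_univ j)
          have := mul_le_mul_of_nonneg_right this (hs j)
          rw [inv_mul_cancel₀ hj.ne'] at this
          linarith
        · simpa using mul_nonneg (Finset.sum_nonneg fun i _ => inv_nonneg.2 (hs i)) (hs j))
    convert this using 1
    conv_lhs => rw [hV.eq]
    rw [← Matrix.smul_mul, ← Matrix.mul_smul, ← Matrix.sub_mul, ← Matrix.mul_sub]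
    congr 2
    ext i j
    by_cases hij : i = j <;> simp [hij, D]
  have := h2.add h1
  rwa [sub_add_sub_cancel] at this

theorem dominated_iff_exists_hockeyStick_le_zero {ρ σ : Matrix n n ℂ} (hρ : IsDensity ρ)
    (hσ : IsDensity σ) : Dominated ρ σ ↔ ∃ γ : ℝ, 0 ≤ γ ∧ hockeyStick γ ρ σ ≤ 0 := by
  constructor
  · intro h
    obtain ⟨γ, hγ⟩ := h.exists_posSemidef hρ hσ.posSemidef
    refine ⟨max γ 0, le_max_right _ _, ?_⟩
    exact (hockeyStick_antitone hρ hσ (le_max_left γ 0)).trans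
      ((hockeyStick_le_zero_iff hρ hσ).2 hγ)
  · rintro ⟨γ, -, hγ⟩
    exact dominated_of_posSemidef hρ.posSemidef hσ.posSemidef
      ((hockeyStick_le_zero_iff hρ hσ).1 hγ)

/-! ### Comparison of the hockey-stick Rényi divergences -/

theorem hockeyStickH_mono {ρ₁ ρ₂ : Matrix n n ℂ} {σ₁ σ₂ : Matrix m m ℂ}
    (h : ∀ γ, 0 ≤ γ → hockeyStick γ σ₁ σ₂ ≤ hockeyStick γ ρ₁ ρ₂)
    (h' : ∀ γ, 0 ≤ γ → hockeyStick γ σ₂ σ₁ ≤ hockeyStick γ ρ₂ ρ₁) (α : ℝ) :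
    hockeyStickH α σ₁ σ₂ ≤ hockeyStickH α ρ₁ ρ₂ := by
  refine mul_le_mul_right (setLIntegral_mono' measurableSet_Ioi fun γ hγ => ?_) _
  have hγ0 : 0 ≤ γ := zero_le_one.trans (le_of_lt hγ)
  refine ENNReal.ofReal_le_ofReal (add_le_add ?_ ?_)
  · exact mul_le_mul_of_nonneg_left (h γ hγ0) (Real.rpow_nonneg hγ0 _)
  · exact mul_le_mul_of_nonneg_left (h' γ hγ0) (Real.rpow_nonneg hγ0 _)

theorem setLIntegral_ofReal_eq_integral {f : ℝ → ℝ} {s : Set ℝ} (hs : MeasurableSet s)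
    (hf : IntegrableOn f s) (h0 : ∀ x ∈ s, 0 ≤ f x) :
    ∫⁻ x in s, ENNReal.ofReal (f x) = ENNReal.ofReal (∫ x in s, f x) :=
  (ofReal_integral_eq_lintegral_ofReal hf
    ((ae_restrict_iff' hs).2 (Eventually.of_forall h0))).symm

/-- Both integrands are bounded using `E_γ ≤ E_1`, and `α (1/(1-α) + 1/α) = 1/(1-α)`. Besides
finiteness this yields `1 + (α-1)H_α ≥ 1 - E_1`, which keeps the logarithm's argument positive for
non-orthogonal states. -/
theorem hockeyStickH_le_of_lt_one {ρ σ : Matrix n n ℂ} (hρ : IsDensity ρ) (hσ : IsDensity σ)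
    {α : ℝ} (h0 : 0 < α) (h1 : α < 1) :
    hockeyStickH α ρ σ ≤ ENNReal.ofReal (hockeyStick 1 ρ σ / (1 - α)) := by
  set t := hockeyStick 1 ρ σ with ht
  have ht0 : 0 ≤ t := hockeyStick_nonneg hρ hσ 1
  have hi1 : IntegrableOn (fun γ : ℝ => γ ^ (α - 2)) (Set.Ioi 1) :=
    integrableOn_Ioi_rpow_of_lt (by linarith) one_pos
  have hi2 : IntegrableOn (fun γ : ℝ => γ ^ (-α - 1)) (Set.Ioi 1) :=
    integrableOn_Ioi_rpow_of_lt (by linarith) one_pos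
  have hle : ∫⁻ γ in Set.Ioi (1 : ℝ), ENNReal.ofReal
        (γ ^ (α - 2) * hockeyStick γ ρ σ + γ ^ (-α - 1) * hockeyStick γ σ ρ) ≤
      ∫⁻ γ in Set.Ioi (1 : ℝ), ENNReal.ofReal (γ ^ (α - 2) * t + γ ^ (-α - 1) * t) := by
    refine setLIntegral_mono' measurableSet_Ioi fun γ hγ => ?_
    have hγ0 : 0 ≤ γ := zero_le_one.trans (le_of_lt hγ)
    refine ENNReal.ofReal_le_ofReal (add_le_add ?_ ?_)
    · exact mul_le_mul_of_nonneg_left (hockeyStick_antitone hρ hσ (le_of_lt hγ))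
        (Real.rpow_nonneg hγ0 _)
    · rw [ht, hockeyStick_one_comm hρ hσ]
      exact mul_le_mul_of_nonneg_left (hockeyStick_antitone hσ hρ (le_of_lt hγ))
        (Real.rpow_nonneg hγ0 _)
  refine (mul_le_mul_right hle _).trans (le_of_eq ?_)
  rw [setLIntegral_ofReal_eq_integral (f := fun γ : ℝ => γ ^ (α - 2) * t + γ ^ (-α - 1) * t)
    measurableSet_Ioi ((hi1.mul_const t).add (hi2.mul_const t)), ← ENNReal.ofReal_mul h0.le,
    integral_add (hi1.mul_const t) (hi2.mul_const t), integral_mul_const, integral_mul_const,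
    integral_Ioi_rpow_of_lt (by linarith) one_pos, integral_Ioi_rpow_of_lt (by linarith) one_pos]
  · congr 1
    have : 1 - α ≠ 0 := by linarith
    have h3 : α - 2 + 1 = -(1 - α) := by ring
    have h4 : -α - 1 + 1 = -α := by ring
    rw [h3, h4, Real.one_rpow, Real.one_rpow]
    field_simp
    ring
  · intro γ hγ
    have hγ0 : (0 : ℝ) ≤ γ := zero_le_one.trans (le_of_lt hγ)
    positivity

theorem Dominated.hockeyStickH_ne_top {ρ σ : Matrix n n ℂ} (hρ : IsDensity ρ) (hσ : IsDensity σ)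
    (h : Dominated ρ σ) {α : ℝ} (hα : 0 < α) : hockeyStickH α ρ σ ≠ ⊤ := by
  obtain ⟨γ₀, hγ₀, hE⟩ := (dominated_iff_exists_hockeyStick_le_zero hρ hσ).1 h
  -- Beyond `γ₀` the first divergence vanishes; up to `γ₀`, `γ^(α-2) ≤ γ₀^α γ^(-2)`. This majorant
  -- is integrable for every `α > 0`.
  have hi : IntegrableOn (fun γ : ℝ => γ₀ ^ α * γ ^ (-2 : ℝ) + γ ^ (-α - 1)) (Set.Ioi 1) :=
    ((integrableOn_Ioi_rpow_of_lt (by norm_num) one_pos).const_mul _).add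
      (integrableOn_Ioi_rpow_of_lt (by linarith) one_pos)
  refine ENNReal.mul_ne_top ENNReal.ofReal_ne_top (ne_top_of_le_ne_top ?_
    (setLIntegral_mono' (g := fun γ : ℝ =>
      ENNReal.ofReal (γ₀ ^ α * γ ^ (-2 : ℝ) + γ ^ (-α - 1))) measurableSet_Ioi fun γ hγ => ?_))
  · rw [setLIntegral_ofReal_eq_integral measurableSet_Ioi hi]
    · exact ENNReal.ofReal_ne_top
    · intro γ hγ
      have hγ0 : (0 : ℝ) ≤ γ := zero_le_one.trans (le_of_lt hγ)
      positivity
  · have hγ0 : 0 < γ := one_pos.trans hγ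
    refine ENNReal.ofReal_le_ofReal (add_le_add ?_ ?_)
    · rcases le_total γ γ₀ with hle | hle
      · calc γ ^ (α - 2) * hockeyStick γ ρ σ ≤ γ ^ (α - 2) * 1 :=
              mul_le_mul_of_nonneg_left (hockeyStick_le_one hρ hσ hγ0.le)
                (Real.rpow_nonneg hγ0.le _)
          _ = γ ^ α * γ ^ (-2 : ℝ) := by rw [mul_one, ← Real.rpow_add hγ0]; rfl
          _ ≤ _ := by gcongr
      · have : hockeyStick γ ρ σ = 0 := le_antisymm
          ((hockeyStick_antitone hρ hσ hle).trans hE) (hockeyStick_nonneg hρ hσ γ)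
        rw [this, mul_zero]; positivity
    · exact mul_le_of_le_one_right (Real.rpow_nonneg hγ0.le _) (hockeyStick_le_one hσ hρ hγ0.le)

theorem Dominated.of_hockeyStick_le {ρ₁ ρ₂ : Matrix n n ℂ} {σ₁ σ₂ : Matrix m m ℂ}
    (hρ₁ : IsDensity ρ₁) (hρ₂ : IsDensity ρ₂) (hσ₁ : IsDensity σ₁) (hσ₂ : IsDensity σ₂)
    (h : ∀ γ, 0 ≤ γ → hockeyStick γ σ₁ σ₂ ≤ hockeyStick γ ρ₁ ρ₂) (hd : Dominated ρ₁ ρ₂) :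
    Dominated σ₁ σ₂ := by
  rw [dominated_iff_exists_hockeyStick_le_zero hσ₁ hσ₂]
  obtain ⟨γ, hγ, hE⟩ := (dominated_iff_exists_hockeyStick_le_zero hρ₁ hρ₂).1 hd
  exact ⟨γ, hγ, (h γ hγ).trans hE⟩

theorem hockeyStickRenyi_le {ρ₁ ρ₂ : Matrix n n ℂ} {σ₁ σ₂ : Matrix m m ℂ}
    (hρ₁ : IsDensity ρ₁) (hρ₂ : IsDensity ρ₂) (hσ₁ : IsDensity σ₁) (hσ₂ : IsDensity σ₂)
    (h : ∀ γ, 0 ≤ γ → hockeyStick γ σ₁ σ₂ ≤ hockeyStick γ ρ₁ ρ₂)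
    (h' : ∀ γ, 0 ≤ γ → hockeyStick γ σ₂ σ₁ ≤ hockeyStick γ ρ₂ ρ₁) {α : ℝ}
    (hα : α ∈ Set.Ico (0 : ℝ) 1 ∪ Set.Ioi 1) :
    hockeyStickRenyi α σ₁ σ₂ ≤ hockeyStickRenyi α ρ₁ ρ₂ := by
  have hdom := Dominated.of_hockeyStick_le hρ₁ hρ₂ hσ₁ hσ₂ h
  have horth : ¬ Orthogonal ρ₁ ρ₂ → ¬ Orthogonal σ₁ σ₂ := by
    rw [orthogonal_iff_one_le_hockeyStick hρ₁ hρ₂, orthogonal_iff_one_le_hockeyStick hσ₁ hσ₂]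
    exact fun hn ho => hn (ho.trans (h 1 zero_le_one))
  unfold hockeyStickRenyi
  by_cases hc : (α < 1 ∧ ¬ Orthogonal ρ₁ ρ₂) ∨ Dominated ρ₁ ρ₂
  swap
  · rw [if_neg hc]; exact le_top
  rw [if_pos hc, if_pos (hc.imp (fun hn => ⟨hn.1, horth hn.2⟩) hdom), EReal.coe_le_coe_iff]
  have hH := hockeyStickH_mono h h' α
  rcases hα with ⟨hα0, hα1⟩ | hα1
  · have hn : ¬ Orthogonal ρ₁ ρ₂ := hc.elim (fun hn => hn.2) fun hd => hd.not_orthogonal hρ₁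
    rcases hα0.eq_or_lt with rfl | hα0
    -- At order zero the prefactor annihilates the integral, even an infinite one, so both
    -- divergences are `0`.
    · simp [hockeyStickH]
    have hE : hockeyStick 1 ρ₁ ρ₂ < 1 := by
      rwa [orthogonal_iff_one_le_hockeyStick hρ₁ hρ₂, not_le] at hn
    have hb := hockeyStickH_le_of_lt_one hρ₁ hρ₂ hα0 hα1
    have hfin : hockeyStickH α ρ₁ ρ₂ ≠ ⊤ := ne_top_of_le_ne_top ENNReal.ofReal_ne_top hb
    have hmono := ENNReal.toReal_mono hfin hH
    have hb' := ENNReal.toReal_mono ENNReal.ofReal_ne_top hb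
    rw [ENNReal.toReal_ofReal (div_nonneg (hockeyStick_nonneg hρ₁ hρ₂ 1) (by linarith)),
      le_div_iff₀ (by linarith)] at hb'
    -- For `α < 1` the logarithm decreases in `H_α`, and the negative prefactor reverses the
    -- inequality again.
    refine mul_le_mul_of_nonpos_left (Real.log_le_log (by linarith) ?_)
      (inv_nonpos.2 (by linarith))
    nlinarith
  · have hα1' : 1 < α := hα1
    have hd : Dominated ρ₁ ρ₂ := hc.resolve_left fun hn => absurd hn.1 (not_lt.2 hα1'.le)
    have hmono := ENNReal.toReal_mono (hd.hockeyStickH_ne_top hρ₁ hρ₂ (by linarith)) hH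
    have h0 : 0 ≤ (hockeyStickH α σ₁ σ₂).toReal := ENNReal.toReal_nonneg
    refine mul_le_mul_of_nonneg_left (Real.log_le_log (by nlinarith) ?_)
      (inv_nonneg.2 (by linarith))
    nlinarith

/-! ### Sylvester's law of inertia and matrix pencils -/

theorem re_dotProduct_congr_diagonal (W : Matrix n n ℂ) (d : n → ℝ) (x : n → ℂ) :
    (star x ⬝ᵥ (Wᴴ * Matrix.diagonal (fun i => (d i : ℂ)) * W) *ᵥ x).re
      = ∑ i, d i * Complex.normSq ((W *ᵥ x) i) := by
  have : star x ⬝ᵥ (Wᴴ * Matrix.diagonal (fun i => (d i : ℂ)) * W) *ᵥ x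
      = star (W *ᵥ x) ⬝ᵥ (Matrix.diagonal (fun i => (d i : ℂ)) *ᵥ (W *ᵥ x)) := by
    rw [Matrix.star_mulVec, ← Matrix.mulVec_mulVec, ← Matrix.mulVec_mulVec,
      Matrix.dotProduct_mulVec]
  rw [this, dotProduct, Complex.re_sum]
  refine Finset.sum_congr rfl fun i _ => ?_
  rw [Matrix.mulVec_diagonal, Pi.star_apply, Complex.star_def, mul_left_comm,
    ← Complex.normSq_eq_conj_mul_self, ← Complex.ofReal_mul, Complex.ofReal_re]

/-- One half of Sylvester's law of inertia. -/
theorem card_pos_le_of_congr_diagonal {W₁ W₂ : Matrix n n ℂ} {d e : n → ℝ} (hW : IsUnit W₁.det)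
    (h : W₁ᴴ * Matrix.diagonal (fun i => (d i : ℂ)) * W₁ =
      W₂ᴴ * Matrix.diagonal (fun i => (e i : ℂ)) * W₂) :
    (Finset.univ.filter fun i => 0 < d i).card ≤ (Finset.univ.filter fun i => 0 < e i).card := by
  by_contra! hlt
  -- More unknowns than equations: some nonzero `x` has `W₁x` supported on `d > 0` while `W₂x`
  -- vanishes on `e > 0`. The common quadratic form would be both positive and nonpositive at `x`.
  set N : Matrix {i // 0 < e i} {i // 0 < d i} ℂ :=
    (W₂ * W₁⁻¹).submatrix Subtype.val Subtype.val with hN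
  have hker : LinearMap.ker N.mulVecLin ≠ ⊥ := by
    apply LinearMap.ker_ne_bot_of_finrank_lt
    simpa [Fintype.card_subtype] using hlt
  obtain ⟨y, hy, hy0⟩ := Submodule.exists_mem_ne_zero_of_ne_bot hker
  have hNy : N *ᵥ y = 0 := hy
  set z : n → ℂ := fun i => if hi : 0 < d i then y ⟨i, hi⟩ else 0 with hz
  set x := W₁⁻¹ *ᵥ z
  have hx : W₁ *ᵥ x = z := by
    rw [Matrix.mulVec_mulVec, Matrix.mul_nonsing_inv _ hW, Matrix.one_mulVec]
  have hw : ∀ i, 0 < e i → (W₂ *ᵥ x) i = 0 := by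
    intro i hi
    have h1 := congrFun hNy ⟨i, hi⟩
    rw [Matrix.mulVec_mulVec]
    rw [Matrix.mulVec, dotProduct] at h1 ⊢
    rw [Pi.zero_apply] at h1
    rw [← h1, ← Fintype.sum_subtype_add_sum_subtype (fun i => 0 < d i), add_eq_left.2]
    · exact Finset.sum_congr rfl fun j _ => by simp [hz, hN, j.2]
    · exact Finset.sum_eq_zero fun j _ => by simp [hz, j.2]
  have hq := congrArg (fun M => (star x ⬝ᵥ M *ᵥ x).re) h
  simp only [re_dotProduct_congr_diagonal, hx] at hq
  have hle : ∑ i, e i * Complex.normSq ((W₂ *ᵥ x) i) ≤ 0 := by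
    refine Finset.sum_nonpos fun i _ => ?_
    rcases lt_or_ge 0 (e i) with hi | hi
    · simp [hw i hi]
    · exact mul_nonpos_of_nonpos_of_nonneg hi (Complex.normSq_nonneg _)
  have hpos : 0 < ∑ i, d i * Complex.normSq (z i) := by
    obtain ⟨⟨j, hj⟩, hyj⟩ := Function.ne_iff.1 hy0
    refine Finset.sum_pos' (fun i _ => ?_) ⟨j, Finset.mem_univ j, ?_⟩
    · by_cases hi : 0 < d i
      · exact mul_nonneg hi.le (Complex.normSq_nonneg _)
      · simp [hz, hi]
    · refine mul_pos hj (Complex.normSq_pos.2 ?_)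
      simpa [hz, hj] using hyj
  linarith

theorem card_pos_eq_of_congr_diagonal {W₁ W₂ : Matrix n n ℂ} {d e : n → ℝ}
    (h₁ : IsUnit W₁.det) (h₂ : IsUnit W₂.det)
    (h : W₁ᴴ * Matrix.diagonal (fun i => (d i : ℂ)) * W₁ =
      W₂ᴴ * Matrix.diagonal (fun i => (e i : ℂ)) * W₂) :
    (Finset.univ.filter fun i => 0 < d i).card = (Finset.univ.filter fun i => 0 < e i).card :=
  le_antisymm (card_pos_le_of_congr_diagonal h₁ h) (card_pos_le_of_congr_diagonal h₂ h.symm)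

open scoped MatrixOrder in
/-- Simultaneous diagonalization of a Hermitian and a positive definite matrix by congruence. -/
theorem exists_congr_diagonal {R S : Matrix n n ℂ} (hR : R.IsHermitian) (hS : S.PosDef) :
    ∃ (W : Matrix n n ℂ) (τ : n → ℝ), IsUnit W.det ∧ S = Wᴴ * W ∧
      R = Wᴴ * Matrix.diagonal (fun i => (τ i : ℂ)) * W := by
  obtain ⟨C, hC⟩ := CStarAlgebra.nonneg_iff_eq_star_mul_self.mp hS.posSemidef.nonneg
  rw [Matrix.star_eq_conjTranspose] at hC
  have hCu : IsUnit C.det := by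
    have := hS.det_pos.ne'
    rw [hC, Matrix.det_mul] at this
    exact isUnit_iff_ne_zero.2 (right_ne_zero_of_mul this)
  have hM : ((C⁻¹)ᴴ * R * C⁻¹).IsHermitian := Matrix.isHermitian_conjTranspose_mul_mul _ hR
  obtain ⟨U, τ, hU⟩ := exists_diagonalizes hM
  refine ⟨Uᴴ * C, τ, ?_, ?_, ?_⟩
  · rw [Matrix.det_mul]
    refine IsUnit.mul ?_ hCu
    exact (Matrix.isUnit_iff_isUnit_det _).1 (IsUnit.of_mul_eq_one U hU.left)
  · rw [Matrix.conjTranspose_mul, Matrix.conjTranspose_conjTranspose, Matrix.mul_assoc,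
      ← Matrix.mul_assoc U, hU.right, Matrix.one_mul, hC]
  · have h1 : C⁻¹ * C = 1 := Matrix.nonsing_inv_mul _ hCu
    have h2 : Cᴴ * (C⁻¹)ᴴ = 1 := by
      rw [← Matrix.conjTranspose_mul, h1, Matrix.conjTranspose_one]
    calc R = Cᴴ * (C⁻¹)ᴴ * R * (C⁻¹ * C) := by rw [h1, h2]; simp
      _ = Cᴴ * ((C⁻¹)ᴴ * R * C⁻¹) * C := by simp only [Matrix.mul_assoc]
      _ = _ := by
        rw [hU.eq, Matrix.conjTranspose_mul, Matrix.conjTranspose_conjTranspose]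
        simp only [Matrix.mul_assoc]

theorem posDef_add_smul_one {ρ : Matrix n n ℂ} (hρ : ρ.PosSemidef) {u : ℝ} (hu : 0 < u) :
    (ρ + (u : ℂ) • 1).PosDef :=
  Matrix.PosDef.posSemidef_add hρ (Matrix.PosDef.one.smul (by exact_mod_cast hu))

theorem Diagonalizes.add_smul_one {U A : Matrix n n ℂ} {e : n → ℝ} (h : Diagonalizes U e A)
    (c : ℝ) : Diagonalizes U (fun i => e i + c) (A + (c : ℂ) • 1) := by
  have := h.sub_smul_one (-c)
  simpa [sub_eq_add_neg] using this

theorem Diagonalizes.isUnit_det {U A : Matrix n n ℂ} {e : n → ℝ} (h : Diagonalizes U e A) :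
    IsUnit (Uᴴ).det :=
  (Matrix.isUnit_iff_isUnit_det _).1 (IsUnit.of_mul_eq_one U h.left)

theorem Diagonalizes.inv_eq {U A : Matrix n n ℂ} {e : n → ℝ} (h : Diagonalizes U e A)
    (he : ∀ i, e i ≠ 0) :
    A⁻¹ = U * Matrix.diagonal (fun i => (((e i)⁻¹ : ℝ) : ℂ)) * Uᴴ := by
  apply Matrix.inv_eq_right_inv
  calc A * (U * Matrix.diagonal (fun i => (((e i)⁻¹ : ℝ) : ℂ)) * Uᴴ)
      = U * Matrix.diagonal (fun i => (e i : ℂ)) * (Uᴴ * U) *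
        Matrix.diagonal (fun i => (((e i)⁻¹ : ℝ) : ℂ)) * Uᴴ := by
        conv_lhs => rw [h.eq]
        simp only [Matrix.mul_assoc]
    _ = U * (Matrix.diagonal (fun i => (e i : ℂ)) *
        Matrix.diagonal (fun i => (((e i)⁻¹ : ℝ) : ℂ))) * Uᴴ := by
        rw [h.left, Matrix.mul_one, Matrix.mul_assoc U]
    _ = 1 := by
        have : (fun i => (e i : ℂ) * (((e i)⁻¹ : ℝ) : ℂ)) = fun _ => 1 := by
          funext i
          rw [← Complex.ofReal_mul, mul_inv_cancel₀ (he i), Complex.ofReal_one]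
        rw [Matrix.diagonal_mul_diagonal, this, Matrix.diagonal_one, Matrix.mul_one, h.right]

/-- The generalized eigenvalues `τ` of the pencil `(ρ + u, σ + u)`: their sum is
`Tr (ρ + u) (σ + u)⁻¹`, their product is the quotient of the determinants, and the number of those
beyond `γ` is read off from the spectrum of `ρ - γ σ`. -/
theorem exists_pencil_eigenvalues {ρ σ U V : Matrix n n ℂ} {r s : n → ℝ} (hρ : ρ.PosSemidef)
    (hσ : σ.PosSemidef) (hU : Diagonalizes U r ρ) (hV : Diagonalizes V s σ) {u : ℝ}
    (hu : 0 < u) :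
    ∃ τ : n → ℝ, (∀ i, 0 < τ i) ∧
      ∑ i, τ i = ∑ i, (((Vᴴ * ρ * V) i i).re + u) / (s i + u) ∧
      ∑ i, Real.log (τ i) = ∑ i, Real.log (r i + u) - ∑ i, Real.log (s i + u) ∧
      (∀ (γ : ℝ) (Q : Matrix n n ℂ) (e : n → ℝ), Diagonalizes Q e (ρ - (γ : ℂ) • σ) →
        (Finset.univ.filter fun i => γ < τ i).card =
          (Finset.univ.filter fun i => (γ - 1) * u < e i).card) ∧
      (∀ (γ : ℝ) (Q : Matrix n n ℂ) (e : n → ℝ), Diagonalizes Q e (σ - (γ : ℂ) • ρ) →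
        (Finset.univ.filter fun i => γ * τ i < 1).card =
          (Finset.univ.filter fun i => (γ - 1) * u < e i).card) := by
  have hR := posDef_add_smul_one hρ hu
  have hS := posDef_add_smul_one hσ hu
  obtain ⟨W, τ, hW, hSW, hRW⟩ := exists_congr_diagonal hR.1 hS
  have hr := hU.nonneg hρ
  have hs := hV.nonneg hσ
  have hWi : W * W⁻¹ = 1 := Matrix.mul_nonsing_inv _ hW
  have hτ : ∀ i, 0 < τ i := by
    have h1 := hR.conjTranspose_mul_mul_same (B := W⁻¹)
      (Matrix.mulVec_injective_of_isUnit ((Matrix.isUnit_iff_isUnit_det _).2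
        (Matrix.isUnit_nonsing_inv_det _ hW)))
    have h2 : (W⁻¹)ᴴ * (ρ + (u : ℂ) • 1) * W⁻¹ = Matrix.diagonal (fun i => (τ i : ℂ)) := by
      rw [hRW]
      calc (W⁻¹)ᴴ * (Wᴴ * Matrix.diagonal (fun i => (τ i : ℂ)) * W) * W⁻¹
          = (W * W⁻¹)ᴴ * Matrix.diagonal (fun i => (τ i : ℂ)) * (W * W⁻¹) := by
            rw [Matrix.conjTranspose_mul]; simp only [Matrix.mul_assoc]
        _ = _ := by rw [hWi]; simp
    rw [h2, Matrix.posDef_diagonal_iff] at h1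
    intro i
    exact_mod_cast h1 i
  refine ⟨τ, hτ, ?_, ?_, ?_, ?_⟩
  · have h1 : ((ρ + (u : ℂ) • 1) * (σ + (u : ℂ) • 1)⁻¹).trace.re = ∑ i, τ i := by
      rw [hSW, Matrix.mul_inv_rev, hRW, Matrix.trace_mul_comm]
      have : W⁻¹ * (Wᴴ)⁻¹ * (Wᴴ * Matrix.diagonal (fun i => (τ i : ℂ)) * W)
          = W⁻¹ * ((Wᴴ)⁻¹ * Wᴴ) * Matrix.diagonal (fun i => (τ i : ℂ)) * W := by
        simp only [Matrix.mul_assoc]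
      rw [this, Matrix.nonsing_inv_mul _ (by rw [Matrix.det_conjTranspose]; exact hW.star),
        Matrix.mul_one, Matrix.trace_mul_cycle, hWi, Matrix.one_mul, Matrix.trace_diagonal]
      simp
    rw [← h1, (hV.add_smul_one u).inv_eq fun i => by have := hs i; positivity,
      re_trace_mul_conj_diagonal]
    refine Finset.sum_congr rfl fun i _ => ?_
    rw [Matrix.mul_add, Matrix.add_mul, div_eq_mul_inv]
    simp [hV.left]
  · have hd := congrArg Matrix.det hRW
    rw [(hU.add_smul_one u).det, Matrix.det_mul, Matrix.det_mul, mul_right_comm,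
      ← Matrix.det_mul, ← hSW, (hV.add_smul_one u).det, Matrix.det_diagonal] at hd
    have hd' : ∏ i, (r i + u) = (∏ i, (s i + u)) * ∏ i, τ i := by exact_mod_cast hd
    have hl := congrArg Real.log hd'
    have hs0 : ∀ i, s i + u ≠ 0 := fun i => by have := hs i; positivity
    rw [Real.log_mul (Finset.prod_ne_zero_iff.2 fun i _ => hs0 i)
        (Finset.prod_ne_zero_iff.2 fun i _ => (hτ i).ne'),
      Real.log_prod fun i _ => by have := hr i; positivity, Real.log_prod fun i _ => hs0 i,
      Real.log_prod fun i _ => (hτ i).ne'] at hl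
    linarith
  · intro γ Q e hQ
    have h1 := hQ.sub_smul_one ((γ - 1) * u)
    -- Both sides are `(ρ + u) - γ(σ + u) = (ρ - γσ) - (γ - 1)u`, so inertia equates the counts.
    have h2 : Wᴴ * Matrix.diagonal (fun i => ((τ i - γ : ℝ) : ℂ)) * W
        = Qᴴᴴ * Matrix.diagonal (fun i => ((e i - (γ - 1) * u : ℝ) : ℂ)) * Qᴴ := by
      have h3 : Matrix.diagonal (fun i => ((τ i - γ : ℝ) : ℂ))
          = Matrix.diagonal (fun i => (τ i : ℂ)) - (γ : ℂ) • 1 := by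
        ext i j
        by_cases hij : i = j <;> simp [hij]
      rw [Matrix.conjTranspose_conjTranspose, ← h1.eq, h3, Matrix.mul_sub, Matrix.sub_mul, ← hRW,
        Matrix.mul_smul, Matrix.smul_mul, Matrix.mul_one, ← hSW]
      push_cast
      module
    simpa using card_pos_eq_of_congr_diagonal hW hQ.isUnit_det h2
  · intro γ Q e hQ
    have h1 := hQ.sub_smul_one ((γ - 1) * u)
    have h2 : Wᴴ * Matrix.diagonal (fun i => ((1 - γ * τ i : ℝ) : ℂ)) * W
        = Qᴴᴴ * Matrix.diagonal (fun i => ((e i - (γ - 1) * u : ℝ) : ℂ)) * Qᴴ := by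
      have h3 : Matrix.diagonal (fun i => ((1 - γ * τ i : ℝ) : ℂ))
          = 1 - (γ : ℂ) • Matrix.diagonal (fun i => (τ i : ℂ)) := by
        ext i j
        by_cases hij : i = j <;> simp [hij]
      rw [Matrix.conjTranspose_conjTranspose, ← h1.eq, h3, Matrix.mul_sub, Matrix.sub_mul,
        Matrix.mul_smul, Matrix.smul_mul, ← hRW, Matrix.mul_one, ← hSW]
      push_cast
      module
    simpa using card_pos_eq_of_congr_diagonal hW hQ.isUnit_det h2

/-! ### Eigenvalue counts and layer cake formulas -/

/-- The number of entries of `e` that exceed `x`. -/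
def countAbove (e : n → ℝ) (x : ℝ) : ℕ := (Finset.univ.filter fun i => x < e i).card

theorem countAbove_eq_sum (e : n → ℝ) (x : ℝ) :
    (countAbove e x : ℝ≥0∞) = ∑ i, if x < e i then 1 else 0 := by
  simp [countAbove]

/-- The count is minus the right derivative of the sum of positive parts, which transfers
measurability from that sum to the count. -/
theorem tendsto_sum_max_sub (e : n → ℝ) (x : ℝ) :
    Tendsto (fun N : ℕ => ((N : ℝ) + 1) * (∑ i, max (e i - x) 0 -
      ∑ i, max (e i - (x + 1 / ((N : ℝ) + 1))) 0)) atTop (𝓝 (countAbove e x : ℝ)) := by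
  have : (countAbove e x : ℝ) = ∑ i, if x < e i then 1 else 0 := by simp [countAbove]
  rw [this]
  simp_rw [← Finset.sum_sub_distrib, Finset.mul_sum]
  refine tendsto_finsetSum _ fun i _ => ?_
  apply tendsto_const_nhds.congr'
  split_ifs with hi
  · have := tendsto_one_div_add_atTop_nhds_zero_nat (𝕜 := ℝ)
    filter_upwards [this.eventually (gt_mem_nhds (sub_pos.2 hi))] with N hN
    rw [max_eq_left (by linarith), max_eq_left (by linarith)]
    have : (N : ℝ) + 1 ≠ 0 := by positivity
    field_simp
    ring
  · refine Eventually.of_forall fun N => ?_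
    have : 0 < 1 / ((N : ℝ) + 1) := by positivity
    simp only
    rw [max_eq_right (by linarith), max_eq_right (by linarith)]
    simp

section Layer

variable {ρ σ : Matrix n n ℂ}

/-- The eigenvalues of `ρ - γ σ`. -/
def relEigenvalues (hρ : ρ.IsHermitian) (hσ : σ.IsHermitian) (γ : ℝ) : n → ℝ :=
  (isHermitian_sub_smul hρ hσ γ).eigenvalues

theorem diagonalizes_relEigenvalues (hρ : ρ.IsHermitian) (hσ : σ.IsHermitian) (γ : ℝ) :
    Diagonalizes ((isHermitian_sub_smul hρ hσ γ).eigenvectorUnitary : Matrix n n ℂ)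
      (relEigenvalues hρ hσ γ) (ρ - (γ : ℂ) • σ) :=
  diagonalizes_eigenvalues _

/-- As a supremum over tests of functions continuous in `p`, the sum is lower semicontinuous; no
measurable choice of eigenvalues is needed. -/
theorem measurable_sum_max_relEigenvalues (hρ : ρ.IsHermitian) (hσ : σ.IsHermitian) :
    Measurable fun p : ℝ × ℝ => ∑ i, max (relEigenvalues hρ hσ p.1 i - p.2) 0 := by
  have hsup : ∀ p : ℝ × ℝ, IsLUB (Set.range fun Λ : {Λ : Matrix n n ℂ // IsTest Λ} =>
      ((Λ : Matrix n n ℂ) * (ρ - (p.1 : ℂ) • σ - (p.2 : ℂ) • 1)).trace.re)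
      (∑ i, max (relEigenvalues hρ hσ p.1 i - p.2) 0) := by
    intro p
    have := ((diagonalizes_relEigenvalues hρ hσ p.1).sub_smul_one p.2).isGreatest_trace_test.isLUB
    have hset : Set.range (fun Λ : {Λ : Matrix n n ℂ // IsTest Λ} =>
        ((Λ : Matrix n n ℂ) * (ρ - (p.1 : ℂ) • σ - (p.2 : ℂ) • 1)).trace.re) =
        {x | ∃ Λ, IsTest Λ ∧ x = (Λ * (ρ - (p.1 : ℂ) • σ - (p.2 : ℂ) • 1)).trace.re} :=
      Set.ext fun x => ⟨fun ⟨Λ, h⟩ => ⟨Λ, Λ.2, h.symm⟩, fun ⟨Λ, hΛ, h⟩ => ⟨⟨Λ, hΛ⟩, h.symm⟩⟩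
    rwa [hset]
  have : Nonempty {Λ : Matrix n n ℂ // IsTest Λ} := ⟨⟨0, isTest_zero⟩⟩
  have heq : (fun p : ℝ × ℝ => ∑ i, max (relEigenvalues hρ hσ p.1 i - p.2) 0) =
      fun p => ⨆ Λ : {Λ : Matrix n n ℂ // IsTest Λ},
        ((Λ : Matrix n n ℂ) * (ρ - (p.1 : ℂ) • σ - (p.2 : ℂ) • 1)).trace.re :=
    funext fun p => (hsup p).ciSup_eq.symm
  rw [heq]
  refine (lowerSemicontinuous_ciSup (fun p => (hsup p).bddAbove) fun Λ => ?_).measurable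
  apply Continuous.lowerSemicontinuous
  simp only [Matrix.mul_sub, Matrix.trace_sub, Matrix.mul_smul, Matrix.trace_smul]
  fun_prop

theorem measurable_countAbove_relEigenvalues (hρ : ρ.IsHermitian) (hσ : σ.IsHermitian) :
    Measurable fun p : ℝ × ℝ => (countAbove (relEigenvalues hρ hσ p.1) p.2 : ℝ≥0∞) := by
  have hT := measurable_sum_max_relEigenvalues hρ hσ
  have hreal : Measurable fun p : ℝ × ℝ => (countAbove (relEigenvalues hρ hσ p.1) p.2 : ℝ) := by
    refine measurable_of_tendsto_metrizable (f := fun (N : ℕ) (p : ℝ × ℝ) => ((N : ℝ) + 1) *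
      (∑ i, max (relEigenvalues hρ hσ p.1 i - p.2) 0 -
        ∑ i, max (relEigenvalues hρ hσ p.1 i - (p.2 + 1 / ((N : ℝ) + 1))) 0)) (fun N => ?_)
      (tendsto_pi_nhds.2 fun p => tendsto_sum_max_sub _ _)
    exact measurable_const.mul (hT.sub
      (hT.comp (measurable_fst.prodMk (measurable_snd.add_const _))))
  simpa using hreal.ennreal_ofReal

theorem lintegral_countAbove (e : n → ℝ) {γ : ℝ} (hγ : 1 < γ) :
    ∫⁻ u in Set.Ioi (0 : ℝ), (countAbove e ((γ - 1) * u) : ℝ≥0∞) =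
      ENNReal.ofReal ((∑ i, max (e i) 0) / (γ - 1)) := by
  have hγ' : 0 < γ - 1 := by linarith
  have hmeas : ∀ i, Measurable fun u : ℝ => if (γ - 1) * u < e i then (1 : ℝ≥0∞) else 0 :=
    fun i => Measurable.ite (measurableSet_lt (by fun_prop) measurable_const)
      measurable_const measurable_const
  simp_rw [countAbove_eq_sum]
  rw [lintegral_finsetSum _ fun i _ => hmeas i, Finset.sum_div,
    ENNReal.ofReal_sum_of_nonneg fun i _ => by positivity]
  refine Finset.sum_congr rfl fun i _ => ?_
  have : (fun u : ℝ => if (γ - 1) * u < e i then (1 : ℝ≥0∞) else 0) =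
      (Set.Iio (e i / (γ - 1))).indicator 1 := by
    ext u
    simp [Set.indicator, lt_div_iff₀' hγ']
  rw [this, lintegral_indicator_one measurableSet_Iio, Measure.restrict_apply measurableSet_Iio,
    Set.inter_comm, Set.Ioi_inter_Iio, Real.volume_Ioo, sub_zero]
  rcases le_total (e i) 0 with hi | hi
  · rw [max_eq_right hi, ENNReal.ofReal_of_nonpos (div_nonpos_of_nonpos_of_nonneg hi hγ'.le)]
    simp
  · rw [max_eq_left hi]

/-- The layer cake formula for the primitive `G` of a weight `w` that starts at `1`. -/
theorem lintegral_weight_mul_ite {w G : ℝ → ℝ} (hw : ∀ x, 1 ≤ x → 0 ≤ w x)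
    (hG : ∀ x, 1 ≤ x → HasDerivAt G (w x) x) (hc : ContinuousOn w (Set.Ici 1)) (t : ℝ) :
    ∫⁻ γ in Set.Ioi (1 : ℝ), ENNReal.ofReal (w γ) * (if γ < t then 1 else 0) =
      ENNReal.ofReal (if 1 < t then G t - G 1 else 0) := by
  have h1 : ∫⁻ γ in Set.Ioi (1 : ℝ), ENNReal.ofReal (w γ) * (if γ < t then 1 else 0) =
      ∫⁻ γ in Set.Ioo 1 t, ENNReal.ofReal (w γ) := by
    rw [← Set.Ioi_inter_Iio, Set.inter_comm, ← Measure.restrict_restrict measurableSet_Iio,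
      ← lintegral_indicator measurableSet_Iio]
    congr 1
    ext γ
    simp [Set.indicator]
  rw [h1]
  split_ifs with ht
  · have hc' : ContinuousOn w (Set.uIcc 1 t) := hc.mono (by
      rw [Set.uIcc_of_le ht.le]; exact fun x hx => hx.1)
    rw [← intervalIntegral.integral_eq_sub_of_hasDerivAt (f' := w) (fun x hx => hG x (by
        rw [Set.uIcc_of_le ht.le] at hx; exact hx.1)) hc'.intervalIntegrable,
      intervalIntegral.integral_of_le ht.le, integral_Ioc_eq_integral_Ioo]
    refine setLIntegral_ofReal_eq_integral measurableSet_Ioo ?_ fun x hx => hw x hx.1.le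
    exact (intervalIntegrable_iff_integrableOn_Ioo_of_le ht.le).1 hc'.intervalIntegrable
  · rw [Set.Ioo_eq_empty ht]; simp

theorem lintegral_one_sub_inv_mul_ite (t : ℝ) :
    ∫⁻ γ in Set.Ioi (1 : ℝ), ENNReal.ofReal (1 - γ⁻¹) * (if γ < t then 1 else 0) =
      ENNReal.ofReal (if 1 < t then t - 1 - Real.log t else 0) := by
  rw [lintegral_weight_mul_ite (G := fun x => x - Real.log x)]
  · simp [sub_right_comm]
  · intro x hx
    exact sub_nonneg.2 (inv_le_one_of_one_le₀ hx)
  · intro x hx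
    exact (hasDerivAt_id x).sub (Real.hasDerivAt_log (by linarith))
  · refine continuousOn_const.sub (continuousOn_id.inv₀ fun x hx => ?_)
    exact (zero_lt_one.trans_le hx).ne'

theorem lintegral_inv_sub_inv_sq_mul_ite (t : ℝ) :
    ∫⁻ γ in Set.Ioi (1 : ℝ), ENNReal.ofReal (γ⁻¹ - (γ ^ 2)⁻¹) * (if γ < t then 1 else 0) =
      ENNReal.ofReal (if 1 < t then t⁻¹ - 1 + Real.log t else 0) := by
  rw [lintegral_weight_mul_ite (G := fun x => x⁻¹ + Real.log x)]
  · simp [add_sub_right_comm]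
  · intro x hx
    exact sub_nonneg.2 (inv_anti₀ (by linarith) (by nlinarith))
  · intro x hx
    have h0 : x ≠ 0 := by linarith
    refine ((hasDerivAt_inv h0).add (Real.hasDerivAt_log h0)).congr_deriv ?_
    ring
  · have h0 : ∀ x ∈ Set.Ici (1 : ℝ), x ≠ 0 := fun x hx => (zero_lt_one.trans_le hx).ne'
    exact (continuousOn_id.inv₀ h0).sub ((continuousOn_id.pow 2).inv₀ fun x hx =>
      pow_ne_zero 2 (h0 x hx))

/-- Only the first integral contributes for `τ > 1`, only the second for `τ < 1`. -/
theorem lintegral_add_lintegral_eq_sub_log {τ : ℝ} (hτ : 0 < τ) :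
    (∫⁻ γ in Set.Ioi (1 : ℝ), ENNReal.ofReal (1 - γ⁻¹) * (if γ < τ then 1 else 0)) +
      (∫⁻ γ in Set.Ioi (1 : ℝ), ENNReal.ofReal (γ⁻¹ - (γ ^ 2)⁻¹) * (if γ < τ⁻¹ then 1 else 0)) =
      ENNReal.ofReal (τ - 1 - Real.log τ) := by
  rw [lintegral_one_sub_inv_mul_ite, lintegral_inv_sub_inv_sq_mul_ite, inv_inv, Real.log_inv]
  rcases lt_trichotomy τ 1 with h | rfl | h
  · rw [if_neg h.not_gt, if_pos ((one_lt_inv₀ hτ).2 h)]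
    simp [sub_eq_add_neg]
  · simp
  · rw [if_pos h, if_neg (by rw [one_lt_inv₀ hτ]; exact h.not_gt)]
    simp

/-- The derivative of `-D(ρ + u ‖ σ + u)` in `u`, in terms of the spectra `r` of `ρ` and `s` of
`σ`, and of the diagonal `p` of `ρ` in an eigenbasis of `σ`. -/
def entropyRate (r s p : n → ℝ) (u : ℝ) : ℝ :=
  ∑ i, ((p i + u) / (s i + u) - 1 - Real.log (r i + u) + Real.log (s i + u))

theorem lintegral_weight_mul_countAbove {w : ℝ → ℝ} (hw : Measurable w) (e : n → ℝ) :
    ∫⁻ γ in Set.Ioi (1 : ℝ), ENNReal.ofReal (w γ) * (countAbove e γ : ℝ≥0∞) =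
      ∑ i, ∫⁻ γ in Set.Ioi (1 : ℝ), ENNReal.ofReal (w γ) * (if γ < e i then 1 else 0) := by
  simp_rw [countAbove_eq_sum, Finset.mul_sum]
  refine lintegral_finsetSum _ fun i _ => hw.ennreal_ofReal.mul ?_
  exact Measurable.ite (measurableSet_lt measurable_id measurable_const) measurable_const
    measurable_const

theorem entropyRate_nonneg_and_eq_lintegral {U V : Matrix n n ℂ} {r s : n → ℝ}
    (hρ : ρ.PosSemidef) (hσ : σ.PosSemidef) (hU : Diagonalizes U r ρ) (hV : Diagonalizes V s σ)
    {u : ℝ} (hu : 0 < u) :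
    0 ≤ entropyRate r s (fun i => ((Vᴴ * ρ * V) i i).re) u ∧
    ENNReal.ofReal (entropyRate r s (fun i => ((Vᴴ * ρ * V) i i).re) u) =
      (∫⁻ γ in Set.Ioi (1 : ℝ), ENNReal.ofReal (1 - γ⁻¹) *
        (countAbove (relEigenvalues hρ.1 hσ.1 γ) ((γ - 1) * u) : ℝ≥0∞)) +
      (∫⁻ γ in Set.Ioi (1 : ℝ), ENNReal.ofReal (γ⁻¹ - (γ ^ 2)⁻¹) *
        (countAbove (relEigenvalues hσ.1 hρ.1 γ) ((γ - 1) * u) : ℝ≥0∞)) := by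
  obtain ⟨τ, hτ, hsum, hlog, h1, h2⟩ := exists_pencil_eigenvalues hρ hσ hU hV hu
  have hrate : entropyRate r s (fun i => ((Vᴴ * ρ * V) i i).re) u =
      ∑ i, (τ i - 1 - Real.log (τ i)) := by
    simp only [entropyRate, Finset.sum_sub_distrib, Finset.sum_add_distrib]
    rw [hsum, hlog]
    ring
  have hnn : ∀ i, 0 ≤ τ i - 1 - Real.log (τ i) := fun i => by
    have := Real.log_le_sub_one_of_pos (hτ i)
    linarith
  rw [hrate]
  refine ⟨Finset.sum_nonneg fun i _ => hnn i, ?_⟩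
  have e1 : ∀ γ, countAbove (relEigenvalues hρ.1 hσ.1 γ) ((γ - 1) * u) = countAbove τ γ :=
    fun γ => (h1 γ _ _ (diagonalizes_relEigenvalues hρ.1 hσ.1 γ)).symm
  have e2 : ∀ γ, countAbove (relEigenvalues hσ.1 hρ.1 γ) ((γ - 1) * u) =
      countAbove (fun i => (τ i)⁻¹) γ := by
    intro γ
    refine (h2 γ _ _ (diagonalizes_relEigenvalues hσ.1 hρ.1 γ)).symm.trans ?_
    simp only [countAbove, ← one_div, lt_div_iff₀ (hτ _)]
  simp_rw [e1, e2]
  rw [lintegral_weight_mul_countAbove (by fun_prop), lintegral_weight_mul_countAbove (by fun_prop),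
    ← Finset.sum_add_distrib, ENNReal.ofReal_sum_of_nonneg fun i _ => hnn i]
  exact Finset.sum_congr rfl fun i _ => (lintegral_add_lintegral_eq_sub_log (hτ i)).symm

theorem measurable_weight_mul_countAbove (hρ : ρ.IsHermitian) (hσ : σ.IsHermitian) {w : ℝ → ℝ}
    (hw : Measurable w) : Measurable fun p : ℝ × ℝ => ENNReal.ofReal (w p.2) *
      (countAbove (relEigenvalues hρ hσ p.2) ((p.2 - 1) * p.1) : ℝ≥0∞) := by
  have hf : Measurable fun p : ℝ × ℝ => (p.2, (p.2 - 1) * p.1) := by fun_prop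
  have h1 := (measurable_countAbove_relEigenvalues hρ hσ).comp hf
  have h2 : Measurable fun p : ℝ × ℝ => ENNReal.ofReal (w p.2) :=
    (hw.comp measurable_snd).ennreal_ofReal
  exact h2.mul h1

/-- After Tonelli, the inner integral over `u` is `E_γ / (γ - 1)`, whose denominator cancels the
factor `γ - 1` of the weight. -/
theorem lintegral_lintegral_countAbove (hρ : ρ.IsHermitian) (hσ : σ.IsHermitian) {w v : ℝ → ℝ}
    (hw : Measurable w) (hwv : ∀ γ, 1 < γ → 0 ≤ w γ ∧ w γ = v γ * (γ - 1)) :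
    ∫⁻ u in Set.Ioi (0 : ℝ), ∫⁻ γ in Set.Ioi (1 : ℝ), ENNReal.ofReal (w γ) *
        (countAbove (relEigenvalues hρ hσ γ) ((γ - 1) * u) : ℝ≥0∞) =
      ∫⁻ γ in Set.Ioi (1 : ℝ), ENNReal.ofReal (v γ * hockeyStick γ ρ σ) := by
  have hm : Measurable fun p : ℝ × ℝ => ENNReal.ofReal (w p.2) *
      (countAbove (relEigenvalues hρ hσ p.2) ((p.2 - 1) * p.1) : ℝ≥0∞) :=
    measurable_weight_mul_countAbove hρ hσ hw
  rw [lintegral_lintegral_swap hm.aemeasurable]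
  refine setLIntegral_congr_fun measurableSet_Ioi fun γ hγ => ?_
  have hγ1 : 0 < γ - 1 := sub_pos.2 hγ
  rw [lintegral_const_mul' _ _ ENNReal.ofReal_ne_top, lintegral_countAbove _ hγ,
    ← hockeyStick_eq_sum (diagonalizes_relEigenvalues hρ hσ γ),
    ← ENNReal.ofReal_mul (hwv γ hγ).1, (hwv γ hγ).2]
  congr 1
  field_simp

theorem lintegral_entropyRate {U V : Matrix n n ℂ} {r s : n → ℝ}
    (hρ : ρ.PosSemidef) (hσ : σ.PosSemidef) (hU : Diagonalizes U r ρ) (hV : Diagonalizes V s σ) :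
    ∫⁻ u in Set.Ioi (0 : ℝ),
        ENNReal.ofReal (entropyRate r s (fun i => ((Vᴴ * ρ * V) i i).re) u) =
      (∫⁻ γ in Set.Ioi (1 : ℝ), ENNReal.ofReal (γ⁻¹ * hockeyStick γ ρ σ)) +
      (∫⁻ γ in Set.Ioi (1 : ℝ), ENNReal.ofReal ((γ ^ 2)⁻¹ * hockeyStick γ σ ρ)) := by
  rw [setLIntegral_congr_fun measurableSet_Ioi fun u hu =>
    (entropyRate_nonneg_and_eq_lintegral hρ hσ hU hV hu).2]
  rw [lintegral_add_left, lintegral_lintegral_countAbove hρ.1 hσ.1 (v := fun γ => γ⁻¹),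
    lintegral_lintegral_countAbove hσ.1 hρ.1 (v := fun γ => (γ ^ 2)⁻¹)]
  · fun_prop
  · intro γ hγ
    have : 0 < γ := by linarith
    have h1 : 0 < γ - 1 := by linarith
    have h2 : γ⁻¹ - (γ ^ 2)⁻¹ = (γ ^ 2)⁻¹ * (γ - 1) := by field_simp
    exact ⟨by rw [h2]; positivity, h2⟩
  · fun_prop
  · intro γ hγ
    have : 0 < γ := by linarith
    have h1 : 0 < γ - 1 := by linarith
    have h2 : 1 - γ⁻¹ = γ⁻¹ * (γ - 1) := by field_simp
    exact ⟨by rw [h2]; positivity, h2⟩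
  · refine Measurable.lintegral_prod_right' (f := fun p : ℝ × ℝ => ENNReal.ofReal (1 - p.2⁻¹) *
      (countAbove (relEigenvalues hρ.1 hσ.1 p.2) ((p.2 - 1) * p.1) : ℝ≥0∞)) ?_
    exact measurable_weight_mul_countAbove hρ.1 hσ.1 (w := fun γ => 1 - γ⁻¹) (by fun_prop)

end Layer

/-! ### The entropy of the shifted pair and the integral representation -/

/-- The relative entropy of `ρ + u` and `σ + u`, in terms of the spectra `r` of `ρ` and `s` of `σ`,
and of the diagonal `p` of `ρ` in an eigenbasis of `σ`. -/
def shiftedEntropy (r s p : n → ℝ) (u : ℝ) : ℝ :=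
  ∑ i, ((r i + u) * Real.log (r i + u) - (p i + u) * Real.log (s i + u))

section

variable {r s p : n → ℝ}

theorem hasDerivAt_shiftedEntropy (hr : ∀ i, 0 ≤ r i) (hs : ∀ i, 0 ≤ s i) {u : ℝ} (hu : 0 < u) :
    HasDerivAt (shiftedEntropy r s p) (-entropyRate r s p u) u := by
  have : -entropyRate r s p u = ∑ i, ((1 * Real.log (r i + u) + (r i + u) * (1 / (r i + u))) -
      (1 * Real.log (s i + u) + (p i + u) * (1 / (s i + u)))) := by
    rw [entropyRate, ← Finset.sum_neg_distrib]
    refine Finset.sum_congr rfl fun i _ => ?_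
    have : r i + u ≠ 0 := by have := hr i; positivity
    rw [mul_one_div_cancel this]
    ring
  rw [this]
  refine HasDerivAt.fun_sum fun i _ => ?_
  have hid : ∀ a : ℝ, HasDerivAt (fun u : ℝ => a + u) 1 u := fun a => (hasDerivAt_id u).const_add a
  exact ((hid _).mul ((hid _).log (by have := hr i; positivity))).sub
    ((hid _).mul ((hid _).log (by have := hs i; positivity)))

theorem continuous_add_mul_log_add (a : ℝ) :
    Continuous fun u : ℝ => (a + u) * Real.log (a + u) :=
  Real.continuous_mul_log.comp (continuous_const.add continuous_id)

/-- A singular logarithm occurs only at `s i = 0`; there `p i = 0` as well, and the term becomes the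
continuous function `u log u`. -/
theorem continuousAt_shiftedEntropy (hp : ∀ i, s i = 0 → p i = 0) :
    ContinuousAt (shiftedEntropy r s p) 0 := by
  refine tendsto_finsetSum _ fun i _ => ?_
  refine (continuous_add_mul_log_add (r i)).continuousAt.sub ?_
  by_cases hi : s i = 0
  · rw [hp i hi, hi]
    exact (continuous_add_mul_log_add 0).continuousAt
  · exact (by fun_prop : ContinuousAt (fun u : ℝ => p i + u) 0).mul
      ((by fun_prop : ContinuousAt (fun u : ℝ => s i + u) 0).log (by simpa using hi))

theorem tendsto_add_mul_log_one_add_div (a b : ℝ) :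
    Tendsto (fun u : ℝ => (a + u) * Real.log (1 + b / u)) atTop (𝓝 b) := by
  have h1 : Tendsto (fun u : ℝ => a * Real.log (1 + b / u)) atTop (𝓝 0) := by
    have h : Tendsto (fun u : ℝ => 1 + b / u) atTop (𝓝 (1 + 0)) :=
      tendsto_const_nhds.add (tendsto_const_nhds.div_atTop tendsto_id)
    rw [add_zero] at h
    simpa using (h.log one_ne_zero).const_mul a
  simpa [add_mul] using h1.add (Real.tendsto_mul_log_one_add_div_atTop b)

theorem tendsto_shiftedEntropy (hr : ∀ i, 0 ≤ r i) (hs : ∀ i, 0 ≤ s i)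
    (hrs : ∑ i, r i = ∑ i, s i) (hrp : ∑ i, r i = ∑ i, p i) :
    Tendsto (shiftedEntropy r s p) atTop (𝓝 0) := by
  have h : Tendsto (fun u : ℝ => ∑ i, ((r i + u) * Real.log (1 + r i / u) -
      (p i + u) * Real.log (1 + s i / u))) atTop (𝓝 (∑ i, (r i - s i))) :=
    tendsto_finsetSum _ fun i _ => (tendsto_add_mul_log_one_add_div _ _).sub
      (tendsto_add_mul_log_one_add_div _ _)
  rw [Finset.sum_sub_distrib, hrs, sub_self] at h
  refine h.congr' ?_
  filter_upwards [eventually_gt_atTop 0] with u hu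
  have hlog : ∀ a, 0 ≤ a → Real.log (1 + a / u) = Real.log (a + u) - Real.log u := by
    intro a ha
    rw [← Real.log_div (by positivity) hu.ne']
    congr 1
    field_simp
    ring
  -- Equal traces cancel the divergent `log u` terms.
  have hz : ∑ i, (r i - p i) * Real.log u = 0 := by
    rw [← Finset.sum_mul, Finset.sum_sub_distrib, hrp, sub_self, zero_mul]
  rw [shiftedEntropy, ← sub_eq_zero, ← Finset.sum_sub_distrib, ← neg_eq_zero, ← hz,
    ← Finset.sum_neg_distrib]
  refine Finset.sum_congr rfl fun i _ => ?_
  rw [hlog _ (hr i), hlog _ (hs i)]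
  ring

/-- The entropy decreases to its limit `0` at infinity, so the sign of its derivative gives
integrability on the half-line together with the fundamental theorem of calculus. -/
theorem lintegral_entropyRate_eq_shiftedEntropy (hr : ∀ i, 0 ≤ r i) (hs : ∀ i, 0 ≤ s i)
    (hrs : ∑ i, r i = ∑ i, s i) (hrp : ∑ i, r i = ∑ i, p i) (hp : ∀ i, s i = 0 → p i = 0)
    (hnn : ∀ u, 0 < u → 0 ≤ entropyRate r s p u) :
    0 ≤ shiftedEntropy r s p 0 ∧
    ∫⁻ u in Set.Ioi (0 : ℝ), ENNReal.ofReal (entropyRate r s p u) =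
      ENNReal.ofReal (shiftedEntropy r s p 0) := by
  have hcont := (continuousAt_shiftedEntropy (r := r) hp).continuousWithinAt (s := Set.Ici 0)
  have hderiv : ∀ u ∈ Set.Ioi (0 : ℝ), HasDerivAt (shiftedEntropy r s p) (-entropyRate r s p u) u :=
    fun u hu => hasDerivAt_shiftedEntropy hr hs hu
  have hneg : ∀ u ∈ Set.Ioi (0 : ℝ), -entropyRate r s p u ≤ 0 :=
    fun u hu => neg_nonpos.2 (hnn u hu)
  have hlim := tendsto_shiftedEntropy hr hs hrs hrp
  have hint := (integrableOn_Ioi_deriv_of_nonpos hcont hderiv hneg hlim).neg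
  have hval := integral_Ioi_of_hasDerivAt_of_nonpos hcont hderiv hneg hlim
  rw [integral_neg, zero_sub, neg_inj] at hval
  refine ⟨hval ▸ setIntegral_nonneg measurableSet_Ioi hnn, ?_⟩
  rw [← hval]
  refine setLIntegral_ofReal_eq_integral measurableSet_Ioi ?_ hnn
  simpa using hint

end

/-- The integral representation of the relative entropy by hockey stick divergences. -/
theorem Dominated.relativeEntropy_eq_lintegral {ρ σ : Matrix n n ℂ} (hρ : IsDensity ρ)
    (hσ : IsDensity σ) (h : Dominated ρ σ) :
    ((∫⁻ γ in Set.Ioi (1 : ℝ), ENNReal.ofReal (γ⁻¹ * hockeyStick γ ρ σ)) +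
      (∫⁻ γ in Set.Ioi (1 : ℝ), ENNReal.ofReal ((γ ^ 2)⁻¹ * hockeyStick γ σ ρ)) : ℝ≥0∞) =
      relativeEntropy ρ σ := by
  have hρP := hρ.posSemidef
  have hσP := hσ.posSemidef
  have hU := diagonalizes_eigenvalues hρP.1
  have hV := diagonalizes_eigenvalues hσP.1
  have hcρ := cfc_eq_conj_diagonal hρP.1 Real.log
  have hcσ := cfc_eq_conj_diagonal hσP.1 Real.log
  have hr := hU.nonneg hρP
  have hs := hV.nonneg hσP
  rw [relativeEntropy, if_pos h, hcρ, hcσ]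
  generalize (hρP.1.eigenvectorUnitary : Matrix n n ℂ) = U at *
  generalize (hσP.1.eigenvectorUnitary : Matrix n n ℂ) = V at *
  generalize hρP.1.eigenvalues = r at *
  generalize hσP.1.eigenvalues = s at *
  have htr : ∑ i, r i = 1 := by
    have := hU.trace.symm.trans hρ.trace_eq_one
    exact_mod_cast this
  have hts : ∑ i, s i = 1 := by
    have := hV.trace.symm.trans hσ.trace_eq_one
    exact_mod_cast this
  have htp : ∑ i, ((Vᴴ * ρ * V) i i).re = 1 := by
    have h1 : (Vᴴ * ρ * V).trace = 1 := by
      rw [Matrix.trace_mul_cycle, hV.right, Matrix.one_mul, hρ.trace_eq_one]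
    have h2 := congrArg Complex.re h1
    simpa [Matrix.trace] using h2
  -- Domination enters here: `ρ` annihilates the kernel of `σ`, which gives continuity of the
  -- shifted entropy at `u = 0`.
  have hp : ∀ i, s i = 0 → ((Vᴴ * ρ * V) i i).re = 0 := by
    intro i hi
    rw [Matrix.mul_assoc, Matrix.mul_apply]
    simp [h.mul_apply_eq_zero hρP hσP hV hi]
  obtain ⟨h0, hI⟩ := lintegral_entropyRate_eq_shiftedEntropy hr hs (htr.trans hts.symm)
    (htr.trans htp.symm) hp fun u hu => (entropyRate_nonneg_and_eq_lintegral hρP hσP hU hV hu).1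
  rw [← lintegral_entropyRate hρP hσP hU hV, hI, EReal.coe_ennreal_ofReal, max_eq_left h0]
  congr 1
  rw [Matrix.mul_sub, Matrix.trace_sub, Complex.sub_re, re_trace_mul_conj_diagonal,
    re_trace_mul_conj_diagonal, ← Finset.sum_sub_distrib, shiftedEntropy]
  refine Finset.sum_congr rfl fun i _ => ?_
  rw [hU.conj_apply]
  simp

theorem relativeEntropy_le {ρ₁ ρ₂ : Matrix n n ℂ} {σ₁ σ₂ : Matrix m m ℂ}
    (hρ₁ : IsDensity ρ₁) (hρ₂ : IsDensity ρ₂) (hσ₁ : IsDensity σ₁) (hσ₂ : IsDensity σ₂)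
    (h : ∀ γ, 0 ≤ γ → hockeyStick γ σ₁ σ₂ ≤ hockeyStick γ ρ₁ ρ₂)
    (h' : ∀ γ, 0 ≤ γ → hockeyStick γ σ₂ σ₁ ≤ hockeyStick γ ρ₂ ρ₁) :
    relativeEntropy σ₁ σ₂ ≤ relativeEntropy ρ₁ ρ₂ := by
  by_cases hd : Dominated ρ₁ ρ₂
  swap
  · rw [relativeEntropy, relativeEntropy, if_neg hd]; exact le_top
  rw [← hd.relativeEntropy_eq_lintegral hρ₁ hρ₂, ← (Dominated.of_hockeyStick_le hρ₁ hρ₂ hσ₁ hσ₂ h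
    hd).relativeEntropy_eq_lintegral hσ₁ hσ₂, EReal.coe_ennreal_le_coe_ennreal_iff]
  refine add_le_add (setLIntegral_mono' measurableSet_Ioi fun γ hγ => ?_)
    (setLIntegral_mono' measurableSet_Ioi fun γ hγ => ?_)
  · have hγ0 : 0 < γ := one_pos.trans hγ
    exact ENNReal.ofReal_le_ofReal (mul_le_mul_of_nonneg_left (h γ hγ0.le) (by positivity))
  · have hγ0 : 0 < γ := one_pos.trans hγ
    exact ENNReal.ofReal_le_ofReal (mul_le_mul_of_nonneg_left (h' γ hγ0.le) (by positivity))

end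

end QuantumDivergence

theorem mainTheorem9 {n m : Type*} [Fintype n] [DecidableEq n] [Fintype m] [DecidableEq m]
    (ρ₁ ρ₂ : Matrix n n ℂ) (σ₁ σ₂ : Matrix m m ℂ)
    (hρ₁ : QuantumDivergence.IsDensity ρ₁) (hρ₂ : QuantumDivergence.IsDensity ρ₂)
    (hσ₁ : QuantumDivergence.IsDensity σ₁) (hσ₂ : QuantumDivergence.IsDensity σ₂)
    (h : ∀ α ∈ Set.Icc (0 : ℝ) 1,
      QuantumDivergence.hypothesisTestingDiv α ρ₁ ρ₂ ≥
        QuantumDivergence.hypothesisTestingDiv α σ₁ σ₂) :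
    (∀ γ : ℝ, 0 ≤ γ →
      QuantumDivergence.hockeyStick γ ρ₁ ρ₂ ≥ QuantumDivergence.hockeyStick γ σ₁ σ₂) ∧
    (∀ α ∈ Set.Ico (0 : ℝ) 1 ∪ Set.Ioi 1,
      QuantumDivergence.hockeyStickRenyi α ρ₁ ρ₂ ≥ QuantumDivergence.hockeyStickRenyi α σ₁ σ₂) ∧
    -- the order zero again, now read as the limit of the orders `α ↓ 0`
    (limsup (fun α : ℝ => QuantumDivergence.hockeyStickRenyi α ρ₁ ρ₂) (𝓝[>] 0) ≥
      limsup (fun α : ℝ => QuantumDivergence.hockeyStickRenyi α σ₁ σ₂) (𝓝[>] 0)) ∧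
    QuantumDivergence.relativeEntropy ρ₁ ρ₂ ≥ QuantumDivergence.relativeEntropy σ₁ σ₂ := by
  have h1 := fun (γ : ℝ) (hγ : 0 ≤ γ) =>
    QuantumDivergence.hockeyStick_le_of_hypothesisTestingDiv_le hρ₁ hρ₂ hσ₁ hσ₂ h hγ
  have h2 := fun (γ : ℝ) (hγ : 0 ≤ γ) =>
    QuantumDivergence.hockeyStick_swap_le_of_hypothesisTestingDiv_le hρ₁ hρ₂ hσ₁ hσ₂ h hγ
  refine ⟨h1, fun α hα => QuantumDivergence.hockeyStickRenyi_le hρ₁ hρ₂ hσ₁ hσ₂ h1 h2 hα, ?_,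
    QuantumDivergence.relativeEntropy_le hρ₁ hρ₂ hσ₁ hσ₂ h1 h2⟩
  refine limsup_le_limsup ?_
  filter_upwards [Ioo_mem_nhdsGT (zero_lt_one' ℝ)] with α hα
  exact QuantumDivergence.hockeyStickRenyi_le hρ₁ hρ₂ hσ₁ hσ₂ h1 h2 (Or.inl ⟨hα.1.le, hα.2⟩)
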